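/- **Theorem (Learning Without Mixing).** For every $C_\eta>0$ there are constants $\bar C,\bar C_3>0$, depending only on $C_\eta$, such that the following holds. Let $d\ge 1$, $T,m\in\mathbb N$, $\sigma>0$, $\delta\in(0,\tfrac12)$, $A^*\in\mathbb R^{d\times d}$, and let $\phi:\mathbb R\to\mathbb R$ be increasing and 1-Lipschitz with $\phi(0)=0$ and $|\phi(x)-\phi(y)|\ge\zeta|x-y|$ for all $x,y$, for some $\zeta>0$. Let $X_0=0$ and $X_{t+1}=\phi(A^*X_t)+\eta_t$ ($\phi$ acting componentwise), where $\eta_0,\dots,\eta_T$ are i.i.d. random vectors in $\mathbb R^d$ with $\mathbb E\eta_t=0$, $\mathbb E\eta_t\eta_t^\top=\sigma^2I$, and $\langle\eta_t,x\rangle$ sub-Gaussian with variance proxy $C_\eta\sigma^2$ (i.e. $\mathbb E e^{\lambda\langle\eta_t,x\rangle}\le e^{C_\eta\sigma^2\lambda^2/2}$ for all $\lambda\in\mathbb R$) for every unit vector $x$. Assume that the system is $(C_\rho,\rho)$ exponentially regular: for every $k\in\mathbb N$, any two solutions $x_0,\dots,x_k$ and $x_0',\dots,x_k'$ of the recursion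 driven by the same deterministic noise sequence satisfy $\|x_k-x_k'\|_2\le C_\rho\rho^k\|x_0-x_0'\|_2$ (here $\rho\ge1$ is allowed, so the system need not mix). Put $$R^*:=C_\rho^2C_\eta d\sigma^2\Big(\sum_{t=0}^{T-1}\rho^t\Big)^2\log\tfrac{4Td}{\delta},\qquad \hat G:=\frac1T\sum_{t=0}^{T-1}X_tX_t^\top .$$ Let $A_m$ be the $m$-th Quasi-Newton iterate with step size $\gamma=\tfrac14$: $A_0=0$ and $$A_{i+1}=A_i-2\gamma\Big(\frac1T\sum_{t=0}^{T-1}(\phi(A_iX_t)-X_{t+1})X_t^\top\Big)\hat G^{-1},$$ with $A_m:=0$ if $\hat G$ is not invertible. Assume $$T\ge\bar C_3\Big(d\log\frac{R^*}{\sigma^2}+\log\frac1\delta\Big),\qquad m\ge\frac{10}{\zeta}\log\Big(\frac{\|A_0-A^*\|_F^2\,TR^*}{\sigma^2d^2}\Big)$$ (the second condition being void when $A^*=A_0$). Then with probability at least $1-\delta$ both of the following hold: $$\|A_m-A^*\|_F^2\le\frac{\bar C\sigma^2}{T\zeta^2\lambda_{\min}(\hat G)}\Big[d^2\log\Big(1+\frac{R^*}{\sigma^2}\Big)+d\log\frac{2d}{\delta}\Big],\qquad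 \lambda_{\min}(\hat G)\ge\frac{\sigma^2}{2}.$$ -/

import Mathlib

open MeasureTheory ProbabilityTheory
open scoped Matrix.Norms.Frobenius

noncomputable section

namespace NLDS

/-- The state space `ℝ^d` with the Euclidean norm. -/
abbrev State (d : ℕ) : Type := EuclideanSpace ℝ (Fin d)

/-- Real `d × d` matrices; throughout, `‖·‖` on them is the Frobenius norm. -/
abbrev Mat (d : ℕ) : Type := Matrix (Fin d) (Fin d) ℝ

/-- `φ(A x)`: the link function `φ` acts componentwise on the vector `A x`. -/
def link {d : ℕ} (φ : ℝ → ℝ) (A : Mat d) (x : State d) : State d :=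
  WithLp.toLp 2 fun i => φ ((A.mulVec x.ofLp) i)

/-- The trajectory `x_0, x_1, …` of `x_{t+1} = φ(A x_t) + e_t` with initial state `x0` and
noise sequence `e`. The state at time `t` depends only on `x0, e_0, …, e_{t-1}`. -/
def trajectory {d : ℕ} (φ : ℝ → ℝ) (A : Mat d) (x0 : State d) (e : ℕ → State d) : ℕ → State d
  | 0 => x0
  | t + 1 => link φ A (trajectory φ A x0 e t) + e t

/-- `φ` is an increasing `1`-Lipschitz link function with `φ 0 = 0` which is expansive with
factor `ζ > 0`. -/
structure IsExpansiveLink (φ : ℝ → ℝ) (ζ : ℝ) : Prop where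
  monotone : Monotone φ
  map_zero : φ 0 = 0
  lipschitz : LipschitzWith 1 φ
  zeta_pos : 0 < ζ
  expansive : ∀ x y : ℝ, ζ * |x - y| ≤ |φ x - φ y|

/-- `(C, ρ)` exponential regularity: two trajectories driven by the same noise satisfy
`‖x_k - x'_k‖ ≤ C ρ^k ‖x_0 - x'_0‖` for every `k`. Nothing forces `ρ < 1`. -/
def IsExpRegular {d : ℕ} (φ : ℝ → ℝ) (A : Mat d) (C ρ : ℝ) : Prop :=
  ∀ (k : ℕ) (x x' : State d) (e : ℕ → State d),
    ‖trajectory φ A x e k - trajectory φ A x' e k‖ ≤ C * ρ ^ k * ‖x - x'‖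

/-- `η_0, …, η_T` are i.i.d. random vectors with mean `0` and covariance `σ² I`. -/
structure IsNoise {Ω : Type*} [MeasurableSpace Ω] {d : ℕ} (P : Measure Ω)
    (η : ℕ → Ω → State d) (T : ℕ) (σ : ℝ) : Prop where
  measurable : ∀ t ≤ T, Measurable (η t)
  indep : iIndepFun (fun t : Fin (T + 1) => η t) P
  identDistrib : ∀ t ≤ T, IdentDistrib (η t) (η 0) P P
  memLp : ∀ t ≤ T, MemLp (η t) 2 P
  mean_zero : ∀ t ≤ T, ∀ i, ∫ ω, η t ω i ∂P = 0
  covariance : ∀ t ≤ T, ∀ i j, ∫ ω, η t ω i * η t ω j ∂P = if i = j then σ ^ 2 else 0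

/-- For every unit vector `x` and every `t ≤ T`, the variable `⟨η_t, x⟩` is sub-Gaussian with
variance proxy `v`. -/
def IsSubGaussianNoise {Ω : Type*} [MeasurableSpace Ω] {d : ℕ} (P : Measure Ω)
    (η : ℕ → Ω → State d) (T : ℕ) (v : ℝ) : Prop :=
  ∀ t ≤ T, ∀ x : State d, ‖x‖ = 1 →
    HasSubgaussianMGF (fun ω => inner ℝ (η t ω) x) v.toNNReal P

/-- The empirical second moment matrix `Ĝ = (1/T) ∑_{t<T} X_t X_tᵀ`. -/
def empGram {d : ℕ} (T : ℕ) (X : ℕ → State d) : Mat d :=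
  (1 / (T : ℝ)) • ∑ t ∈ Finset.range T, Matrix.vecMulVec (X t).ofLp (X t).ofLp

theorem empGram_isHermitian {d : ℕ} (T : ℕ) (X : ℕ → State d) : (empGram T X).IsHermitian := by
  ext i j
  simp [empGram, Matrix.sum_apply, Matrix.vecMulVec_apply, mul_comm]

/-- `λ_min(Ĝ)`, the smallest eigenvalue of the empirical second moment matrix. -/
def lambdaMinGram {d : ℕ} (T : ℕ) (X : ℕ → State d) : ℝ :=
  ⨅ i, (empGram_isHermitian T X).eigenvalues i

/-- The convex proxy loss
`(1/T) ∑_{t<T} ∑_i (φ̄(⟨a_i, X_t⟩) - ⟨e_i, X_{t+1}⟩ ⟨a_i, X_t⟩)` with `φ̄(x) = ∫_0^x φ`. -/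
def proxyLoss {d : ℕ} (φ : ℝ → ℝ) (T : ℕ) (X : ℕ → State d) (A : Mat d) : ℝ :=
  (1 / (T : ℝ)) * ∑ t ∈ Finset.range T, ∑ i,
    ((∫ s in (0 : ℝ)..(A.mulVec (X t).ofLp) i, φ s) - X (t + 1) i * (A.mulVec (X t).ofLp) i)

/-- The gradient of the proxy loss, `(1/T) ∑_{t<T} (φ(A X_t) - X_{t+1}) X_tᵀ`. -/
def proxyGrad {d : ℕ} (φ : ℝ → ℝ) (T : ℕ) (X : ℕ → State d) (A : Mat d) : Mat d :=
  (1 / (T : ℝ)) • ∑ t ∈ Finset.range T,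
    Matrix.vecMulVec (link φ A (X t) - X (t + 1)).ofLp (X t).ofLp

/-- `proxyGrad` is the gradient of `proxyLoss` for the entrywise inner product of matrices. -/
theorem hasDerivAt_proxyLoss {d : ℕ} {φ : ℝ → ℝ} (hφ : Continuous φ) (T : ℕ)
    (X : ℕ → State d) (A H : Mat d) :
    HasDerivAt (fun s : ℝ => proxyLoss φ T X (A + s • H))
      (∑ i, ∑ j, proxyGrad φ T X A i j * H i j) 0 := by
  have key : ∀ (t : ℕ) (i : Fin d), HasDerivAt
      (fun s : ℝ => (∫ r in (0 : ℝ)..((A + s • H).mulVec (X t).ofLp) i, φ r)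
        - X (t + 1) i * ((A + s • H).mulVec (X t).ofLp) i)
      (φ ((A.mulVec (X t).ofLp) i) * (H.mulVec (X t).ofLp) i
        - X (t + 1) i * (H.mulVec (X t).ofLp) i) 0 := by
    intro t i
    have hlin : HasDerivAt (fun s : ℝ => ((A + s • H).mulVec (X t).ofLp) i)
        ((H.mulVec (X t).ofLp) i) 0 := by
      have h0 : HasDerivAt (fun s : ℝ => (A.mulVec (X t).ofLp) i + s * (H.mulVec (X t).ofLp) i)
          (1 * (H.mulVec (X t).ofLp) i) 0 :=
        ((hasDerivAt_id (0 : ℝ)).mul_const _).const_add _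
      simpa [Matrix.add_mulVec, Matrix.smul_mulVec] using h0
    have hint : HasDerivAt (fun u : ℝ => ∫ r in (0 : ℝ)..u, φ r)
        (φ (((A + (0 : ℝ) • H).mulVec (X t).ofLp) i)) (((A + (0 : ℝ) • H).mulVec (X t).ofLp) i) :=
      hφ.integral_hasStrictDerivAt _ _ |>.hasDerivAt
    have hcomp := HasDerivAt.comp (0 : ℝ) hint hlin
    refine HasDerivAt.congr_deriv (hcomp.sub (hlin.const_mul (X (t + 1) i))) ?_
    simp
  have hsum := (HasDerivAt.fun_sum (u := Finset.range T) fun t _ =>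
    HasDerivAt.fun_sum (u := Finset.univ) fun i _ => key t i).const_mul (1 / (T : ℝ))
  refine hsum.congr_deriv ?_
  simp only [proxyGrad, Matrix.smul_apply, Matrix.sum_apply, Matrix.vecMulVec_apply, smul_eq_mul,
    Finset.mul_sum, Finset.sum_mul, link, Matrix.mulVec, dotProduct, WithLp.ofLp_sub,
    Pi.sub_apply, ← Finset.sum_sub_distrib]
  rw [Finset.sum_comm]
  refine Finset.sum_congr rfl fun i _ => ?_
  rw [Finset.sum_comm]
  refine Finset.sum_congr rfl fun j _ => Finset.sum_congr rfl fun t _ => ?_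
  ring

open Classical in
/-- The Quasi-Newton iterates with step size `γ` on the data `X_0, …, X_T`: `A_0 = 0` and
`A_{i+1} = A_i - 2 γ ∇L_prox(A_i) Ĝ⁻¹`; the estimate is `0` if `Ĝ` is not invertible. -/
def quasiNewton {d : ℕ} (φ : ℝ → ℝ) (γ : ℝ) (T : ℕ) (X : ℕ → State d) : ℕ → Mat d
  | 0 => 0
  | i + 1 =>
    if IsUnit (empGram T X) then
      quasiNewton φ γ T X i
        - (2 * γ) • (proxyGrad φ T X (quasiNewton φ γ T X i) * (empGram T X)⁻¹)
    else 0

/-- `R* = C_ρ² C_η d σ² (∑_{t=0}^{T-1} ρ^t)² log(4 T d / δ)`. -/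
def Rstar (d T : ℕ) (Cη σ Cρ ρ δ : ℝ) : ℝ :=
  Cρ ^ 2 * Cη * d * σ ^ 2 * (∑ t ∈ Finset.range T, ρ ^ t) ^ 2 * Real.log (4 * T * d / δ)

end NLDS

end

namespace NLDS

/-! The argument separates a deterministic contraction from two martingale estimates, neither of
which needs mixing.

Fix a row and measure vectors by `‖design T X ·‖`, that is, by the quadratic form of `T Ĝ`. Since
the step is preconditioned by `Ĝ⁻¹`, the new error is the least squares projection of the vector
with entries `x - y - (φ x - φ y) / 2` (predictions under the iterate and under the truth), plus
half the projection `b` of the noise. Slopes of `φ` lie in `[ζ, 1]`, so those entries shrink by `1 -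
ζ/2`, and projections do not expand. Iterating gives `norm_design_quasiNewton_le`: a geometrically
small term plus `‖design T X b‖ / ζ`. Dividing squares by `T λ_min(Ĝ)` returns to the Frobenius
norm.

To bound `‖design T X b‖`, note that `⟨g, L u⟩ - (v/2) ‖L u‖²` has maximum `‖L b‖² / (2v)` over `u`.
For fixed `u` its exponential has mean at most one, because `η_t` is independent of `X_t` and
sub-Gaussian. A union bound over a grid finishes (`IsNormalSolution.norm_le_of_net`).

For `λ_min(Ĝ)`, each `X_{t+1}` is a function of the past plus fresh noise. The lower-tail
exponential moment of `(a + ⟨η_t, u⟩)²` is controlled uniformly in the shift `a`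
(`integral_exp_neg_sq_le`), so the past can only help and another exponential supermartingale gives
the lower tail.

Both grids need an a priori bound on the states. Exponential regularity and a union bound on noise
coordinates give `‖X_t‖² ≤ 2 R*`. This size enters only through the mesh, hence only
logarithmically. -/

theorem partial_sum_le_cosh (x : ℝ) : 1 + x ^ 2 / 2 + x ^ 4 / 24 ≤ Real.cosh x := by
  have h := sum_le_hasSum (Finset.range 3) (fun n _ => by rw [pow_mul]; positivity) (Real.hasSum_cosh x)
  simpa [Finset.sum_range_succ, Nat.factorial] using h

theorem exp_neg_le_one_sub_add_sq {a : ℝ} (ha : 0 ≤ a) : Real.exp (-a) ≤ 1 - a + a ^ 2 := by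
  rcases le_total a 1 with h | h
  · have h1 := Real.abs_exp_sub_one_sub_id_le (x := -a) (by rw [abs_neg, abs_of_nonneg ha]; exact h)
    have h2 := (abs_le.1 h1).2
    nlinarith
  · have : Real.exp (-a) ≤ 1 := Real.exp_le_one_iff.2 (by linarith)
    nlinarith

/-! ### Moments of sub-Gaussian variables, from comparison with `cosh`. -/

section Moments

variable {Ω : Type*} [MeasurableSpace Ω] {P : Measure Ω} {X : Ω → ℝ} {v : NNReal}

theorem integrable_cosh_of_subgaussian (h : HasSubgaussianMGF X v P) (s : ℝ) :
    Integrable (fun ω => Real.cosh (s * X ω)) P := by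
  have := ((h.integrable_exp_mul s).add (h.integrable_exp_mul (-s))).div_const 2
  refine this.congr (Filter.Eventually.of_forall fun ω => ?_)
  simp [Real.cosh_eq]

theorem integral_cosh_le_of_subgaussian (h : HasSubgaussianMGF X v P) (s : ℝ) :
    ∫ ω, Real.cosh (s * X ω) ∂P ≤ Real.exp (v * s ^ 2 / 2) := by
  have h1 := h.mgf_le s
  have h2 := h.mgf_le (-s)
  have : ∫ ω, Real.cosh (s * X ω) ∂P = (mgf X P s + mgf X P (-s)) / 2 := by
    simp only [mgf]
    rw [← integral_add (h.integrable_exp_mul s) (h.integrable_exp_mul (-s)), ← integral_div]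
    simp [Real.cosh_eq]
  rw [this]
  rw [neg_sq] at h2
  linarith

variable [IsProbabilityMeasure P]

theorem integrable_pow_of_subgaussian (h : HasSubgaussianMGF X v P) (n : ℕ) :
    Integrable (fun ω => X ω ^ n) P := by
  have := (h.memLp n).integrable_norm_pow' 
  refine (integrable_norm_iff (h.aestronglyMeasurable.pow n)).1 ?_
  simpa using this

theorem integral_sq_le_of_subgaussian (h : HasSubgaussianMGF X v P) (hv : 0 < v) :
    ∫ ω, X ω ^ 2 ∂P ≤ v := by
  set s := ∫ ω, X ω ^ 2 ∂P with hs
  have hv' : (0 : ℝ) < v := hv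
  have key : ∀ y : ℝ, 0 ≤ y → 1 + y * s ≤ Real.exp (v * y) := by
    intro y hy
    have h1 : ∫ ω, (1 + y * X ω ^ 2) ∂P ≤ ∫ ω, Real.cosh (Real.sqrt (2 * y) * X ω) ∂P := by
      refine integral_mono ((integrable_const _).add
        ((integrable_pow_of_subgaussian h 2).const_mul y))
        (integrable_cosh_of_subgaussian h _) fun ω => ?_
      have h2 := partial_sum_le_cosh (Real.sqrt (2 * y) * X ω)
      have h3 : (Real.sqrt (2 * y) * X ω) ^ 2 = 2 * y * X ω ^ 2 := by
        rw [mul_pow, Real.sq_sqrt (by positivity)]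
      have h4 : 0 ≤ (Real.sqrt (2 * y) * X ω) ^ 4 := by positivity
      simp only
      linarith
    rw [integral_add (integrable_const _) ((integrable_pow_of_subgaussian h 2).const_mul y),
      integral_const_mul] at h1
    have h5 := integral_cosh_le_of_subgaussian h (Real.sqrt (2 * y))
    rw [Real.sq_sqrt (by positivity)] at h5
    have h6 : (v : ℝ) * (2 * y) / 2 = v * y := by ring
    rw [h6] at h5
    simp only [integral_const, probReal_univ, smul_eq_mul, mul_one] at h1
    linarith
  by_contra! hlt
  have hspos : 0 < s := hv'.trans hlt
  -- With `exp (v y) ≤ 1 / (1 - v y)`, the inequality `key` becomes `s - v ≤ y s v`. This `y` makes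
  -- the right side `(s - v) / 2`, a contradiction.
  set y := (s - v) / (2 * s * v) with hy
  have hy0 : 0 < y := div_pos (by linarith) (by positivity)
  have hvy : (v : ℝ) * y = (s - v) / (2 * s) := by rw [hy]; field_simp
  have hvy1 : (v : ℝ) * y < 1 := by
    rw [hvy, div_lt_one (by positivity)]; linarith
  have h1 := (key y hy0.le).trans (Real.exp_bound_div_one_sub_of_interval (by positivity) hvy1)
  rw [le_div_iff₀ (by linarith)] at h1
  have h2 : y * s * (v * y) = y * ((s - v) / 2) := by
    rw [hvy]; field_simp
  nlinarith [mul_pos hy0 (sub_pos.2 hlt)]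

theorem integral_pow_four_le_of_subgaussian (h : HasSubgaussianMGF X v P) (hv : 0 < v) :
    ∫ ω, X ω ^ 4 ∂P ≤ 48 * (v : ℝ) ^ 2 := by
  have hv' : (0 : ℝ) < v := hv
  -- At scale `1/√v` the `cosh` moment is at most `exp (1/2) ≤ 2`, and the quartic Taylor term has
  -- weight `1/24`; hence `48 = 24 * 2`.
  have h1 : ∫ ω, X ω ^ 4 / (24 * (v : ℝ) ^ 2) ∂P
      ≤ ∫ ω, Real.cosh ((Real.sqrt v)⁻¹ * X ω) ∂P := by
    refine integral_mono ((integrable_pow_of_subgaussian h 4).div_const _)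
      (integrable_cosh_of_subgaussian h _) fun ω => ?_
    have h2 := partial_sum_le_cosh ((Real.sqrt v)⁻¹ * X ω)
    have h3 : ((Real.sqrt v)⁻¹ * X ω) ^ 4 = X ω ^ 4 / (v : ℝ) ^ 2 := by
      rw [mul_pow, inv_pow, show (4 : ℕ) = 2 * 2 from rfl, pow_mul (Real.sqrt v),
        Real.sq_sqrt hv'.le]
      field_simp
    have h4 : X ω ^ 4 / (24 * (v : ℝ) ^ 2) = X ω ^ 4 / (v : ℝ) ^ 2 / 24 := by
      field_simp
    have h5 := sq_nonneg ((Real.sqrt v)⁻¹ * X ω)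
    simp only
    rw [h4, ← h3]
    linarith
  have h2 := integral_cosh_le_of_subgaussian h (Real.sqrt v)⁻¹
  rw [inv_pow, Real.sq_sqrt hv'.le, mul_inv_cancel₀ hv'.ne'] at h2
  have h3 : Real.exp (1 / 2) ≤ 2 := by
    have h4 := Real.exp_bound_div_one_sub_of_interval (x := 1 / 2) (by norm_num) (by norm_num)
    norm_num at h4 ⊢
    exact h4
  rw [integral_div] at h1
  have h5 := (h1.trans h2).trans h3
  rw [div_le_iff₀ (by positivity)] at h5
  linarith

/-- Lower-tail exponential moment of the square of a shifted sub-Gaussian variable, uniformly in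
the shift. -/
theorem integral_exp_neg_sq_le (h : HasSubgaussianMGF X v P) (hv : 0 < v) {lam : ℝ}
    (hlam : 0 ≤ lam) (hlv : 4 * lam * v ≤ 1) (a : ℝ) :
    ∫ ω, Real.exp (-(lam * (a + X ω) ^ 2)) ∂P
      ≤ Real.exp (-(lam * ∫ ω, X ω ^ 2 ∂P) + 96 * lam ^ 2 * (v : ℝ) ^ 2) := by
  have i2 := integrable_pow_of_subgaussian h 2
  have i4 := integrable_pow_of_subgaussian h 4
  have i1 := (h.integrable_exp_mul (-(4 * lam * a))).const_mul (Real.exp (-(2 * lam * a ^ 2)))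
  have i3 : Integrable (fun ω => 1 - 2 * lam * X ω ^ 2) P :=
    (integrable_const (1 : ℝ)).sub (i2.const_mul (2 * lam))
  have ir : Integrable (fun ω => 1 - 2 * lam * X ω ^ 2 + 4 * lam ^ 2 * X ω ^ 4) P :=
    i3.add (i4.const_mul (4 * lam ^ 2))
  -- Write the exponential as a product of the shift and cross terms with `exp (-λ X²)` and apply
  -- `2pq ≤ p² + q²`. The first square has mean at most one because `4 λ v ≤ 1` lets `a²` absorb the
  -- cross term; the second no longer involves `a`.
  have hpt : ∀ ω, Real.exp (-(lam * (a + X ω) ^ 2)) ≤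
      (Real.exp (-(2 * lam * a ^ 2)) * Real.exp (-(4 * lam * a) * X ω)
        + (1 - 2 * lam * X ω ^ 2 + 4 * lam ^ 2 * X ω ^ 4)) / 2 := by
    intro ω
    have e1 : Real.exp (-(lam * (a + X ω) ^ 2))
        = Real.exp (-(lam * a ^ 2) + -(2 * lam * a) * X ω) * Real.exp (-(lam * X ω ^ 2)) := by
      rw [← Real.exp_add]; ring_nf
    have e2 : Real.exp (-(2 * lam * a ^ 2)) * Real.exp (-(4 * lam * a) * X ω)
        = Real.exp (-(lam * a ^ 2) + -(2 * lam * a) * X ω) ^ 2 := by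
      rw [← Real.exp_add, ← Real.exp_nat_mul]; push_cast; ring_nf
    have e3 : Real.exp (-(lam * X ω ^ 2)) ^ 2 ≤ 1 - 2 * lam * X ω ^ 2 + 4 * lam ^ 2 * X ω ^ 4 := by
      have := exp_neg_le_one_sub_add_sq (a := 2 * lam * X ω ^ 2) (by positivity)
      rw [← Real.exp_nat_mul]
      push_cast
      calc _ = Real.exp (-(2 * lam * X ω ^ 2)) := by ring_nf
        _ ≤ _ := this
        _ = _ := by ring
    rw [e1, e2]
    nlinarith [sq_nonneg (Real.exp (-(lam * a ^ 2) + -(2 * lam * a) * X ω)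
      - Real.exp (-(lam * X ω ^ 2)))]
  have hint : ∫ ω, Real.exp (-(lam * (a + X ω) ^ 2)) ∂P ≤
      ∫ ω, (Real.exp (-(2 * lam * a ^ 2)) * Real.exp (-(4 * lam * a) * X ω)
        + (1 - 2 * lam * X ω ^ 2 + 4 * lam ^ 2 * X ω ^ 4)) / 2 ∂P := by
    refine integral_mono_of_nonneg (Filter.Eventually.of_forall fun ω => (Real.exp_pos _).le)
      ((i1.add ir).div_const 2) (Filter.Eventually.of_forall hpt)
  refine hint.trans ?_
  have hval : ∫ ω, (Real.exp (-(2 * lam * a ^ 2)) * Real.exp (-(4 * lam * a) * X ω)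
        + (1 - 2 * lam * X ω ^ 2 + 4 * lam ^ 2 * X ω ^ 4)) / 2 ∂P
      = (Real.exp (-(2 * lam * a ^ 2)) * mgf X P (-(4 * lam * a))
        + (1 - 2 * lam * (∫ ω, X ω ^ 2 ∂P) + 4 * lam ^ 2 * ∫ ω, X ω ^ 4 ∂P)) / 2 := by
    rw [integral_div, integral_add i1 ir, integral_const_mul,
      integral_add i3 (i4.const_mul (4 * lam ^ 2)),
      integral_sub (integrable_const (μ := P) (1 : ℝ)) (i2.const_mul (2 * lam)),
      integral_const_mul, integral_const_mul]
    simp [mgf]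
  rw [hval]
  have hm : Real.exp (-(2 * lam * a ^ 2)) * mgf X P (-(4 * lam * a)) ≤ 1 := by
    calc _ ≤ Real.exp (-(2 * lam * a ^ 2)) * Real.exp (v * (-(4 * lam * a)) ^ 2 / 2) := by
          gcongr; exact h.mgf_le _
      _ = Real.exp (-(2 * lam * a ^ 2 * (1 - 4 * lam * v))) := by
          rw [← Real.exp_add]; ring_nf
      _ ≤ 1 := Real.exp_le_one_iff.2 (by
          have : 0 ≤ 1 - 4 * lam * v := by linarith
          have : 0 ≤ 2 * lam * a ^ 2 * (1 - 4 * lam * v) := by positivity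
          linarith)
  have h4 := integral_pow_four_le_of_subgaussian h hv
  have h5 : 4 * lam ^ 2 * ∫ ω, X ω ^ 4 ∂P ≤ 4 * lam ^ 2 * (48 * (v : ℝ) ^ 2) := by gcongr
  have h6 := Real.add_one_le_exp (-(lam * ∫ ω, X ω ^ 2 ∂P) + 96 * lam ^ 2 * (v : ℝ) ^ 2)
  linarith

end Moments

/-- If `Z` is independent of `H` and `g (h, Z)` has mean at most `1` for every fixed `h`, then
multiplying by `g (H, Z)` does not increase the mean of a function of `H`. -/
theorem lintegral_mul_le_of_indepFun {Ω α β : Type*} [MeasurableSpace Ω] [MeasurableSpace α]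
    [MeasurableSpace β] {P : Measure Ω} [IsProbabilityMeasure P] {H : Ω → α} {Z : Ω → β}
    (hH : Measurable H) (hZ : Measurable Z) (hind : IndepFun H Z P) {F : α → ENNReal}
    (hF : Measurable F) {g : α → β → ENNReal} (hg : Measurable (Function.uncurry g))
    (hle : ∀ h, ∫⁻ ω, g h (Z ω) ∂P ≤ 1) :
    ∫⁻ ω, F (H ω) * g (H ω) (Z ω) ∂P ≤ ∫⁻ ω, F (H ω) ∂P := by
  have hmap := (indepFun_iff_map_prod_eq_prod_map_map hH.aemeasurable hZ.aemeasurable).1 hind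
  have hG : Measurable fun z : α × β => F z.1 * g z.1 z.2 := (hF.comp measurable_fst).mul hg
  calc ∫⁻ ω, F (H ω) * g (H ω) (Z ω) ∂P
      = ∫⁻ z, F z.1 * g z.1 z.2 ∂(P.map fun ω => (H ω, Z ω)) :=
        (lintegral_map hG (hH.prodMk hZ)).symm
    _ = ∫⁻ h, ∫⁻ z, F h * g h z ∂(P.map Z) ∂(P.map H) := by
        have := Measure.isProbabilityMeasure_map (μ := P) hZ.aemeasurable
        rw [hmap, lintegral_prod _ hG.aemeasurable]
    _ ≤ ∫⁻ h, F h ∂(P.map H) := by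
        refine lintegral_mono fun h => ?_
        have hgh : Measurable (g h) := hg.comp measurable_prodMk_left
        rw [lintegral_const_mul _ hgh, lintegral_map hgh hZ]
        exact mul_le_of_le_one_right' (hle h)
    _ = ∫⁻ ω, F (H ω) ∂P := lintegral_map hF hH

/-! ### Trajectories as functions of the noise. -/

section Trajectory

variable {d : ℕ} {φ : ℝ → ℝ} {A : Mat d}

theorem trajectory_congr {x0 : State d} {e e' : ℕ → State d} {t : ℕ}
    (h : ∀ s < t, e s = e' s) : trajectory φ A x0 e t = trajectory φ A x0 e' t := by
  induction t with
  | zero => rfl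
  | succ t ih =>
    simp only [trajectory, ih fun s hs => h s (hs.trans t.lt_succ_self), h t t.lt_succ_self]

theorem trajectory_succ_shift (x0 : State d) (e : ℕ → State d) (t : ℕ) :
    trajectory φ A x0 e (t + 1)
      = trajectory φ A (link φ A x0 + e 0) (fun s => e (s + 1)) t := by
  induction t with
  | zero => rfl
  | succ t ih => rw [trajectory, ih]; rfl

theorem link_zero (h0 : φ 0 = 0) : link φ A 0 = 0 := by
  ext i
  simp [link, h0]

theorem continuous_link (hφ : Continuous φ) : Continuous (link φ A) := by
  unfold link
  refine (PiLp.continuous_toLp 2 _).comp (continuous_pi fun i => hφ.comp ?_)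
  simp only [Matrix.mulVec, dotProduct]
  fun_prop

theorem measurable_trajectory (hφ : Continuous φ) (x0 : State d) (t : ℕ) :
    Measurable fun e : ℕ → State d => trajectory φ A x0 e t := by
  induction t with
  | zero => exact measurable_const
  | succ t ih =>
    exact ((continuous_link hφ).measurable.comp ih).add (measurable_pi_apply t)

/-- Exponential regularity bounds a trajectory started at `0` by the size of its noise. -/
theorem norm_trajectory_le (h0 : φ 0 = 0) {C ρ M : ℝ} (hreg : IsExpRegular φ A C ρ)
    (hC : 0 ≤ C) (hρ : 0 ≤ ρ) (t : ℕ) (e : ℕ → State d) (he : ∀ s < t, ‖e s‖ ≤ M) :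
    ‖trajectory φ A 0 e t‖ ≤ C * (∑ k ∈ Finset.range t, ρ ^ k) * M := by
  induction t generalizing e with
  | zero => simp [trajectory]
  | succ t ih =>
    -- After one step from `0` the state is `e 0`. Comparing with a restart at `0` under the
    -- remaining noise charges `C ρ^t ‖e 0‖` to regularity and leaves the rest to induction.
    rw [trajectory_succ_shift, link_zero h0, zero_add]
    have h1 := hreg t (e 0) 0 fun s => e (s + 1)
    have h2 := ih (fun s => e (s + 1)) fun s hs => he (s + 1) (by omega)
    have h3 : C * ρ ^ t * ‖e 0 - 0‖ ≤ C * ρ ^ t * M := by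
      rw [sub_zero]
      gcongr
      exact he 0 (by omega)
    calc _ = ‖(trajectory φ A (e 0) (fun s => e (s + 1)) t
              - trajectory φ A 0 (fun s => e (s + 1)) t)
            + trajectory φ A 0 (fun s => e (s + 1)) t‖ := by rw [sub_add_cancel]
      _ ≤ _ := norm_add_le _ _
      _ ≤ C * ρ ^ t * M + C * (∑ k ∈ Finset.range t, ρ ^ k) * M := by linarith
      _ = _ := by rw [Finset.sum_range_succ]; ring

end Trajectory

/-! ### Exponential supermartingales along the trajectory. -/

section ExponentialSupermartingale

variable {Ω : Type*} [MeasurableSpace Ω] {P : Measure Ω} {d T : ℕ} {η : ℕ → Ω → State d}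

/-- Extension by zero of a noise sequence observed up to time `t`. -/
def extendNoise (T t : ℕ) (h : (Finset.univ.filter fun i : Fin (T + 1) => (i : ℕ) < t) → State d)
    (n : ℕ) : State d :=
  if hn : n < t ∧ n < T + 1 then h ⟨⟨n, hn.2⟩, by simpa using hn.1⟩ else 0

theorem measurable_extendNoise (T t : ℕ) : Measurable (extendNoise (d := d) T t) := by
  refine measurable_pi_iff.2 fun n => ?_
  unfold extendNoise
  split_ifs with hn
  · exact measurable_pi_apply _
  · exact measurable_const

theorem measurable_trajectory_noise {φ : ℝ → ℝ} {A : Mat d} {σ : ℝ} (hη : IsNoise P η T σ) (hφ : Continuous φ) {t : ℕ}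
    (ht : t ≤ T + 1) : Measurable fun ω => trajectory φ A 0 (fun n => η n ω) t := by
  induction t with
  | zero => exact measurable_const
  | succ t ih =>
    exact ((continuous_link hφ).measurable.comp (ih (by omega))).add (hη.measurable t (by omega))

variable [IsProbabilityMeasure P] {φ : ℝ → ℝ} {A : Mat d}

/-- Exponential supermartingale: if `exp (ψ x η_t)` has mean at most `1` for every fixed state
`x`, so does `exp (∑_{s<t} ψ X_s η_s)`. -/
theorem lintegral_exp_sum_le_one {σ : ℝ} (hη : IsNoise P η T σ) (hφ : Continuous φ)
    {ψ : State d → State d → ℝ} (hψ : Measurable (Function.uncurry ψ))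
    (hle : ∀ t ≤ T, ∀ x, ∫⁻ ω, ENNReal.ofReal (Real.exp (ψ x (η t ω))) ∂P ≤ 1) :
    ∀ t ≤ T + 1, ∫⁻ ω, ENNReal.ofReal (Real.exp (∑ s ∈ Finset.range t,
      ψ (trajectory φ A 0 (fun n => η n ω) s) (η s ω))) ∂P ≤ 1 := by
  intro t
  induction t with
  | zero => intro _; simp
  | succ t ih =>
    intro ht
    have htT : t < T + 1 := by omega
    -- The history `H` of noises before time `t` is independent of `η t` and determines every state
    -- up to and including time `t`; so the last factor can be integrated out with `H` frozen.
    let S := Finset.univ.filter fun i : Fin (T + 1) => (i : ℕ) < t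
    let H : Ω → (S → State d) := fun ω i => η i ω
    have hmeas : ∀ i : Fin (T + 1), Measurable (η i) := fun i => hη.measurable i (by omega)
    have hH : Measurable H := measurable_pi_iff.2 fun i => hmeas i
    have hind : IndepFun H (η t) P := by
      have h1 := hη.indep.indepFun_finset S {⟨t, htT⟩} (by simp [S]) hmeas
      have h2 : Measurable fun z : ({⟨t, htT⟩} : Finset (Fin (T + 1))) → State d =>
          z ⟨⟨t, htT⟩, by simp⟩ := measurable_pi_apply _
      exact h1.comp measurable_id h2
    have hext : ∀ ω, ∀ s < t, extendNoise T t (H ω) s = η s ω := by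
      intro ω s hs
      simp [extendNoise, hs, hs.trans htT, H]
    have htraj : ∀ ω, ∀ s ≤ t, trajectory φ A 0 (fun n => η n ω) s
        = trajectory φ A 0 (extendNoise T t (H ω)) s := fun ω s hs =>
      trajectory_congr fun r hr => (hext ω r (hr.trans_le hs)).symm
    let F : (S → State d) → ENNReal := fun h => ENNReal.ofReal (Real.exp (∑ s ∈ Finset.range t,
      ψ (trajectory φ A 0 (extendNoise T t h) s) (extendNoise T t h s)))
    let g : (S → State d) → State d → ENNReal := fun h z =>
      ENNReal.ofReal (Real.exp (ψ (trajectory φ A 0 (extendNoise T t h) t) z))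
    have hX : ∀ s, Measurable fun h : S → State d => trajectory φ A 0 (extendNoise T t h) s :=
      fun s => (measurable_trajectory hφ 0 s).comp (measurable_extendNoise T t)
    have hF : Measurable F := by
      refine ENNReal.measurable_ofReal.comp (Real.measurable_exp.comp
        (Finset.measurable_fun_sum _ fun s _ => hψ.comp ((hX s).prodMk ?_)))
      exact (measurable_pi_apply s).comp (measurable_extendNoise T t)
    have hg : Measurable (Function.uncurry g) :=
      ENNReal.measurable_ofReal.comp (Real.measurable_exp.comp
        (hψ.comp (((hX t).comp measurable_fst).prodMk measurable_snd)))
    have hFH : ∀ ω, F (H ω) = ENNReal.ofReal (Real.exp (∑ s ∈ Finset.range t,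
        ψ (trajectory φ A 0 (fun n => η n ω) s) (η s ω))) := by
      intro ω
      simp only [F]
      congr 2
      refine Finset.sum_congr rfl fun s hs => ?_
      have hs' := Finset.mem_range.1 hs
      rw [htraj ω s hs'.le, hext ω s hs']
    have key := lintegral_mul_le_of_indepFun hH (hη.measurable t (by omega)) hind hF hg
      fun h => hle t (by omega) _
    calc _ = ∫⁻ ω, F (H ω) * g (H ω) (η t ω) ∂P := by
          refine lintegral_congr fun ω => ?_
          rw [hFH, Finset.sum_range_succ, Real.exp_add, ENNReal.ofReal_mul (Real.exp_pos _).le,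
            htraj ω t le_rfl]
      _ ≤ ∫⁻ ω, F (H ω) ∂P := key
      _ ≤ 1 := by simp only [hFH]; exact ih (by omega)

/-- Chernoff bound for the exponential supermartingale. -/
theorem measureReal_sum_ge_le {σ : ℝ} (hη : IsNoise P η T σ) (hφ : Continuous φ)
    {ψ : State d → State d → ℝ} (hψ : Measurable (Function.uncurry ψ))
    (hle : ∀ t ≤ T, ∀ x, ∫⁻ ω, ENNReal.ofReal (Real.exp (ψ x (η t ω))) ∂P ≤ 1)
    {t : ℕ} (ht : t ≤ T + 1) (a : ℝ) :
    P.real {ω | a ≤ ∑ s ∈ Finset.range t,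
      ψ (trajectory φ A 0 (fun n => η n ω) s) (η s ω)} ≤ Real.exp (-a) := by
  have hm : Measurable fun ω => ENNReal.ofReal (Real.exp (∑ s ∈ Finset.range t,
      ψ (trajectory φ A 0 (fun n => η n ω) s) (η s ω))) := by
    refine ENNReal.measurable_ofReal.comp (Real.measurable_exp.comp
      (Finset.measurable_fun_sum _ fun s hs => ?_))
    have hs' := Finset.mem_range.1 hs
    exact hψ.comp ((measurable_trajectory_noise hη hφ (by omega)).prodMk
      (hη.measurable s (by omega)))
  have h1 := (mul_meas_ge_le_lintegral (μ := P) hm (ENNReal.ofReal (Real.exp a))).trans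
    (lintegral_exp_sum_le_one hη hφ hψ hle t ht)
  simp only [ENNReal.ofReal_le_ofReal_iff (Real.exp_pos _).le, Real.exp_le_exp] at h1
  have h2 := ENNReal.toReal_mono ENNReal.one_ne_top h1
  rw [ENNReal.toReal_mul, ENNReal.toReal_ofReal (Real.exp_pos _).le, ENNReal.toReal_one] at h2
  rw [Real.exp_neg, ← one_div, le_div_iff₀ (Real.exp_pos _), mul_comm]
  exact h2

end ExponentialSupermartingale

/-! ### Least squares projections. -/

section LeastSquares

variable {E F : Type*} [NormedAddCommGroup E] [InnerProductSpace ℝ E] [NormedAddCommGroup F]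
  [InnerProductSpace ℝ F]

/-- `p` solves the normal equations of the least squares problem `L p ≈ g`. -/
def IsNormalSolution (L : E →ₗ[ℝ] F) (g : F) (p : E) : Prop :=
  ∀ w, inner ℝ (L p) (L w) = inner ℝ g (L w)

/-- `L p` is the orthogonal projection of `g` onto the range of `L`. This is the nonexpansiveness
used in the Quasi-Newton contraction. -/
theorem IsNormalSolution.norm_le {L : E →ₗ[ℝ] F} {g : F} {p : E} (h : IsNormalSolution L g p) :
    ‖L p‖ ≤ ‖g‖ := by
  have h1 : ‖L p‖ ^ 2 ≤ ‖g‖ * ‖L p‖ := by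
    rw [← real_inner_self_eq_norm_sq, h p]
    exact real_inner_le_norm _ _
  rcases (norm_nonneg (L p)).eq_or_lt with h0 | h0
  · rw [← h0]; exact norm_nonneg _
  · nlinarith

/-- A least squares solution is small if the self-normalized quadratic form it maximizes is
small on a sufficiently fine net. -/
theorem IsNormalSolution.norm_le_of_net {L : E →ₗ[ℝ] F} {g : F} {b : E}
    (h : IsNormalSolution L g b) {c M τ ε r ℓ β : ℝ} {N : Set E} (hc : 0 < c) (hτ : 0 < τ)
    (hβ : 0 < β) (hlow : ∀ w, τ * ‖w‖ ^ 2 ≤ ‖L w‖ ^ 2)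
    (hup : ∀ w, ‖L w‖ ≤ M * ‖w‖)
    (hM : 0 ≤ M) (hr : β ≤ r * (c * Real.sqrt τ)) (hεM : M * ε ≤ β / (8 * c))
    (hnet : ∀ u : E, ‖u‖ ≤ r → ∃ u' ∈ N, ‖u - u'‖ ≤ ε)
    (hN : ∀ u ∈ N, inner ℝ g (L u) - c / 2 * ‖L u‖ ^ 2 < ℓ) (hℓ : 5 * c * ℓ ≤ β ^ 2) :
    ‖L b‖ ≤ β := by
  by_contra! hlt
  set B := ‖L b‖ with hB
  have hB0 : 0 < B := hβ.trans hlt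
  -- The quadratic form peaks at `b / c`, which may be far away. Shrinking along this ray until `‖L
  -- u‖ = β / c` puts `u` in the ball covered by the net while the form still exceeds `ℓ`.
  set u : E := (β / (B * c)) • b with hu
  have hLu : L u = (β / (B * c)) • L b := by rw [hu, map_smul]
  have hLun : ‖L u‖ = β / c := by
    rw [hLu, norm_smul, Real.norm_of_nonneg (by positivity), ← hB]
    field_simp
  have hur : ‖u‖ ≤ r := by
    have h1 := hlow u
    rw [hLun] at h1
    have h2 : Real.sqrt τ * ‖u‖ ≤ β / c := by
      refine abs_le_of_sq_le_sq' ?_ (by positivity) |>.2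
      rw [mul_pow, Real.sq_sqrt hτ.le]; exact h1
    rw [le_div_iff₀ hc] at h2
    have h3 : (0 : ℝ) < c * Real.sqrt τ := mul_pos hc (Real.sqrt_pos.2 hτ)
    by_contra! hcon
    nlinarith
  obtain ⟨u', hu'N, hu'⟩ := hnet u hur
  set κ := ‖L u' - L u‖ with hκ
  have hκle : κ ≤ β / (8 * c) := by
    rw [hκ, ← map_sub]
    refine (hup _).trans (le_trans ?_ hεM)
    rw [norm_sub_rev]
    gcongr
  have hκ0 : 0 ≤ κ := norm_nonneg _
  have hval := hN u' hu'N
  rw [← h u'] at hval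
  have h1 : inner ℝ (L b) (L u') = β * B / c + inner ℝ (L b) (L u' - L u) := by
    rw [inner_sub_right, hLu, inner_smul_right, real_inner_self_eq_norm_sq, ← hB]
    field_simp
    ring
  have h2 : -(B * κ) ≤ inner ℝ (L b) (L u' - L u) :=
    (abs_le.1 (abs_real_inner_le_norm (L b) (L u' - L u))).1
  have h3 : ‖L u'‖ ≤ β / c + κ := by
    have := norm_add_le (L u) (L u' - L u)
    rw [add_sub_cancel, hLun] at this
    exact this
  have hs : β / (8 * c) = β / c / 8 := by field_simp
  set y := β / c with hy
  have hyc : β = y * c := by rw [hy]; field_simp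
  have hy0 : 0 < y := by positivity
  have h4 : β * B / c = y * B := by rw [hyc]; field_simp
  rw [hs] at hκle
  have h5 : ‖L u'‖ ^ 2 ≤ (9 / 8 * y) ^ 2 := by
    refine pow_le_pow_left₀ (norm_nonneg _) ?_ 2
    linarith
  have h6 : c / 2 * ‖L u'‖ ^ 2 ≤ c / 2 * (9 / 8 * y) ^ 2 := by gcongr
  have h7 : B * κ ≤ B * (y / 8) := by gcongr
  have h8 : y * (y * c) ≤ y * B := by
    rw [← hyc]; gcongr
  have h9 : 7 / 8 * (y * (y * c)) - c / 2 * (9 / 8 * y) ^ 2 < ℓ := by linarith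
  have h10 : 5 * c * ℓ ≤ (y * c) ^ 2 := by rw [← hyc]; exact hℓ
  have h11 : 5 * ℓ ≤ y ^ 2 * c := by
    by_contra! hcon
    nlinarith
  -- The form at `u'` is at least `(7/8 - 81/128) c y² = (31/128) c y²`, above the bound `c y² / 5 ≥
  -- ℓ`.
  nlinarith [mul_pos (pow_pos hy0 2) hc]

end LeastSquares

/-! ### The design map and the spectrum of the empirical second moment. -/

section Design

variable {d T : ℕ} {X : ℕ → State d}

/-- The linear map `v ↦ (⟨X_t, v⟩)_{t<T}`. -/
noncomputable def design (T : ℕ) (X : ℕ → State d) : State d →ₗ[ℝ] EuclideanSpace ℝ (Fin T) where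
  toFun v := WithLp.toLp 2 fun t => inner ℝ (X t) v
  map_add' v w := by ext t; simp [inner_add_right]
  map_smul' r v := by ext t; simp [inner_smul_right]

@[simp] theorem design_apply (v : State d) (t : Fin T) : design T X v t = inner ℝ (X t) v := rfl

theorem norm_design_sq (v : State d) :
    ‖design T X v‖ ^ 2 = ∑ t ∈ Finset.range T, inner ℝ (X t) v ^ 2 := by
  rw [EuclideanSpace.norm_sq_eq, Finset.sum_range]
  simp

theorem inner_design (g : ℕ → ℝ) (v : State d) :
    inner ℝ (WithLp.toLp 2 fun t : Fin T => g t) (design T X v)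
      = ∑ t ∈ Finset.range T, inner ℝ (X t) v * g t := by
  rw [Finset.sum_range, PiLp.inner_apply]
  simp

theorem norm_design_le {R : ℝ} (hR : 0 ≤ R) (hX : ∀ t < T, ‖X t‖ ≤ R) (v : State d) :
    ‖design T X v‖ ≤ Real.sqrt T * R * ‖v‖ := by
  refine abs_le_of_sq_le_sq' ?_ (by positivity) |>.2
  rw [norm_design_sq]
  calc ∑ t ∈ Finset.range T, inner ℝ (X t) v ^ 2 ≤ ∑ t ∈ Finset.range T, (R * ‖v‖) ^ 2 := by
        refine Finset.sum_le_sum fun t ht => ?_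
        rw [← sq_abs]
        refine pow_le_pow_left₀ (abs_nonneg _) ((abs_real_inner_le_norm _ _).trans ?_) 2
        have := hX t (Finset.mem_range.1 ht)
        gcongr
    _ = (Real.sqrt T * R * ‖v‖) ^ 2 := by
        rw [Finset.sum_const, Finset.card_range, nsmul_eq_mul, mul_assoc, mul_pow (Real.sqrt T),
          Real.sq_sqrt (Nat.cast_nonneg T)]

theorem inner_eq_dotProduct (v w : State d) : inner ℝ v w = v.ofLp ⬝ᵥ w.ofLp := by
  rw [PiLp.inner_apply]
  simp [dotProduct, mul_comm]

theorem vecMul_sum_vecMulVec (a : Fin d → ℝ) :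
    Matrix.vecMul a (empGram T X)
      = (1 / (T : ℝ)) • ∑ t ∈ Finset.range T, (a ⬝ᵥ (X t).ofLp) • (X t).ofLp := by
  rw [empGram, Matrix.vecMul_smul, Matrix.vecMul_sum]
  simp [Matrix.vecMul_vecMulVec]

theorem vecMul_empGram_dotProduct (p w : State d) :
    Matrix.vecMul p.ofLp (empGram T X) ⬝ᵥ w.ofLp
      = (1 / (T : ℝ)) * inner ℝ (design T X p) (design T X w) := by
  have h := inner_design (T := T) (X := X) (fun t => inner ℝ (X t) p) w
  rw [show (design T X p) = WithLp.toLp 2 fun t : Fin T => inner ℝ (X t) p from rfl, h,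
    vecMul_sum_vecMulVec, smul_dotProduct, sum_dotProduct, smul_eq_mul]
  congr 1
  refine Finset.sum_congr rfl fun t _ => ?_
  rw [smul_dotProduct, inner_eq_dotProduct, inner_eq_dotProduct, smul_eq_mul, mul_comm,
    dotProduct_comm p.ofLp]

/-- A row vector `p` with `p Ĝ = (1/T) ∑ g_t X_tᵀ` solves the normal equations with data `g`. -/
theorem isNormalSolution_of_vecMul (hT : 0 < T) {p : State d} {g : ℕ → ℝ}
    (h : Matrix.vecMul p.ofLp (empGram T X)
      = (1 / (T : ℝ)) • ∑ t ∈ Finset.range T, g t • (X t).ofLp) :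
    IsNormalSolution (design T X) (WithLp.toLp 2 fun t : Fin T => g t) p := by
  intro w
  have h1 := vecMul_empGram_dotProduct (T := T) (X := X) p w
  rw [h, smul_dotProduct, sum_dotProduct, smul_eq_mul] at h1
  have hT' : (0 : ℝ) < 1 / (T : ℝ) := by positivity
  rw [inner_design, ← mul_left_cancel₀ hT'.ne' h1]
  refine Finset.sum_congr rfl fun t _ => ?_
  rw [smul_dotProduct, inner_eq_dotProduct, smul_eq_mul, mul_comm]

theorem norm_design_sq_eq_sum_eigenvalues (hT : 0 < T) (v : State d) :
    ‖design T X v‖ ^ 2 = T * ∑ i, (empGram_isHermitian T X).eigenvalues i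
      * inner ℝ ((empGram_isHermitian T X).eigenvectorBasis i) v ^ 2 := by
  set hG := empGram_isHermitian T X
  have h1 := vecMul_empGram_dotProduct (T := T) (X := X) v v
  rw [real_inner_self_eq_norm_sq] at h1
  have hT' : (T : ℝ) ≠ 0 := by positivity
  have h2 : ‖design T X v‖ ^ 2
      = T * (Matrix.vecMul v.ofLp (empGram T X) ⬝ᵥ v.ofLp) := by
    rw [h1]; field_simp
  rw [h2]
  congr 1
  have h3 := hG.eigenvectorBasis.sum_inner_mul_inner
    (WithLp.toLp 2 (Matrix.vecMul v.ofLp (empGram T X))) v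
  rw [inner_eq_dotProduct] at h3
  rw [← h3]
  refine Finset.sum_congr rfl fun i _ => ?_
  rw [inner_eq_dotProduct (WithLp.toLp 2 _), ← Matrix.dotProduct_mulVec,
    hG.mulVec_eigenvectorBasis, dotProduct_smul, ← inner_eq_dotProduct, smul_eq_mul,
    real_inner_comm]
  ring

theorem lambdaMinGram_mul_norm_sq_le (hT : 0 < T) (v : State d) :
    T * lambdaMinGram T X * ‖v‖ ^ 2 ≤ ‖design T X v‖ ^ 2 := by
  rw [norm_design_sq_eq_sum_eigenvalues hT,
    ← (empGram_isHermitian T X).eigenvectorBasis.sum_sq_norm_inner_right, mul_assoc,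
    Finset.mul_sum]
  refine mul_le_mul_of_nonneg_left (Finset.sum_le_sum fun i _ => ?_) (Nat.cast_nonneg T)
  rw [Real.norm_eq_abs, sq_abs]
  exact mul_le_mul_of_nonneg_right (ciInf_le (Set.finite_range _).bddBelow i) (sq_nonneg _)

theorem le_lambdaMinGram (hd : 0 < d) (hT : 0 < T) {s : ℝ}
    (h : ∀ u : State d, ‖u‖ = 1 → T * s ≤ ‖design T X u‖ ^ 2) : s ≤ lambdaMinGram T X := by
  have : Nonempty (Fin d) := ⟨⟨0, hd⟩⟩
  refine le_ciInf fun i => ?_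
  set hG := empGram_isHermitian T X
  have h1 := h (hG.eigenvectorBasis i) (hG.eigenvectorBasis.norm_eq_one i)
  have h2 : ‖design T X (hG.eigenvectorBasis i)‖ ^ 2 = T * hG.eigenvalues i := by
    rw [norm_design_sq_eq_sum_eigenvalues hT]
    congr 1
    rw [Finset.sum_eq_single i]
    · simp
    · intro j _ hj
      rw [hG.eigenvectorBasis.inner_eq_zero hj]
      simp
    · simp
  rw [h2] at h1
  exact le_of_mul_le_mul_left h1 (by positivity)

theorem isUnit_empGram (h : 0 < lambdaMinGram T X) : IsUnit (empGram T X) :=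
  ((empGram_isHermitian T X).posDef_iff_eigenvalues_pos.2 fun i =>
    h.trans_le (ciInf_le (Set.finite_range _).bddBelow i)).isUnit

end Design

/-! ### Contraction of the Quasi-Newton iteration. -/

section QuasiNewton

variable {d T : ℕ} {X : ℕ → State d} {φ : ℝ → ℝ} {ζ : ℝ}

theorem IsExpansiveLink.abs_sub_le (h : IsExpansiveLink φ ζ) (x y : ℝ) :
    |φ x - φ y| ≤ |x - y| := by
  simpa [Real.dist_eq] using h.lipschitz.dist_le_mul x y

theorem IsExpansiveLink.zeta_le_one (h : IsExpansiveLink φ ζ) : ζ ≤ 1 := by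
  have h1 := (h.expansive 1 0).trans (h.abs_sub_le 1 0)
  simpa using h1

/-- By monotonicity `φ x - φ y` has the sign of `x - y`, and it is between `ζ` and `1` times as
large. A half step therefore leaves a fraction in `[1/2, 1 - ζ/2]` and never overshoots. -/
theorem IsExpansiveLink.abs_sub_half_le (h : IsExpansiveLink φ ζ) (x y : ℝ) :
    |x - y - 1 / 2 * (φ x - φ y)| ≤ (1 - ζ / 2) * |x - y| := by
  have h1 := h.abs_sub_le x y
  have h2 := h.expansive x y
  rcases le_total y x with hxy | hxy
  · have h3 := h.monotone hxy
    rw [abs_of_nonneg (sub_nonneg.2 hxy)] at *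
    rw [abs_of_nonneg (sub_nonneg.2 h3)] at *
    rw [abs_le]
    constructor <;> linarith
  · have h3 := h.monotone hxy
    rw [abs_of_nonpos (sub_nonpos.2 hxy)] at *
    rw [abs_of_nonpos (sub_nonpos.2 h3)] at *
    rw [abs_le]
    constructor <;> linarith

theorem link_apply (A : Mat d) (x : State d) (i : Fin d) :
    link φ A x i = φ (A i ⬝ᵥ x.ofLp) := rfl

theorem proxyGrad_row (A : Mat d) (j : Fin d) :
    proxyGrad φ T X A j = (1 / (T : ℝ)) • ∑ t ∈ Finset.range T,
      (φ (A j ⬝ᵥ (X t).ofLp) - X (t + 1) j) • (X t).ofLp := by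
  ext i
  simp [proxyGrad, Matrix.sum_apply, Matrix.vecMulVec_apply, link_apply]

theorem vecMul_mul_inv_row (hG : IsUnit (empGram T X)) (W : Mat d) (j : Fin d) :
    Matrix.vecMul ((W * (empGram T X)⁻¹) j) (empGram T X) = W j := by
  rw [Matrix.mul_apply_eq_vecMul, Matrix.vecMul_vecMul,
    Matrix.nonsing_inv_mul _ ((Matrix.isUnit_iff_isUnit_det _).1 hG), Matrix.vecMul_one]

/-- Row `j` of `A` as a vector in the state space. -/
def rowState (A : Mat d) (j : Fin d) : State d := WithLp.toLp 2 (A j)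

theorem norm_sq_eq_sum_rowState (A : Mat d) : ‖A‖ ^ 2 = ∑ j, ‖rowState A j‖ ^ 2 := by
  rw [Matrix.frobenius_norm_def, ← Real.sqrt_eq_rpow, Real.sq_sqrt (by positivity)]
  simp [EuclideanSpace.norm_sq_eq, rowState]

variable {Astar : Mat d} {e : ℕ → State d}

theorem norm_design_quasiNewton_succ_le (hφ : IsExpansiveLink φ ζ) (hT : 0 < T)
    (hG : IsUnit (empGram T X)) (hX : ∀ t < T, X (t + 1) = link φ Astar (X t) + e t)
    (j : Fin d) {b : State d} (hb : Matrix.vecMul b.ofLp (empGram T X)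
      = (1 / (T : ℝ)) • ∑ t ∈ Finset.range T, e t j • (X t).ofLp) (k : ℕ) :
    ‖design T X (rowState (quasiNewton φ (1 / 4) T X (k + 1) - Astar) j)‖
      ≤ (1 - ζ / 2) * ‖design T X (rowState (quasiNewton φ (1 / 4) T X k - Astar) j)‖
        + 1 / 2 * ‖design T X b‖ := by
  set A := quasiNewton φ (1 / 4) T X k with hA
  set W := proxyGrad φ T X A with hW
  set r : State d := rowState (W * (empGram T X)⁻¹) j with hr
  -- The gradient row carries the noise with a minus sign; adding `b` cancels it. Thus `q` solves
  -- normal equations with noise-free data, and the new error is `q + b / 2`.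
  set q : State d := rowState (A - Astar) j - (1 / 2 : ℝ) • (r + b) with hq
  have hstep : rowState (quasiNewton φ (1 / 4) T X (k + 1) - Astar) j
      = q + (1 / 2 : ℝ) • b := by
    rw [quasiNewton, if_pos hG]
    ext i
    simp [hq, hr, rowState, hA, hW]
    ring
  have hqG : Matrix.vecMul q.ofLp (empGram T X) = (1 / (T : ℝ)) • ∑ t ∈ Finset.range T,
      ((A j ⬝ᵥ (X t).ofLp) - (Astar j ⬝ᵥ (X t).ofLp) - 1 / 2 *
        (φ (A j ⬝ᵥ (X t).ofLp) - φ (Astar j ⬝ᵥ (X t).ofLp))) • (X t).ofLp := by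
    have e1 : q.ofLp = (A - Astar) j - (1 / 2 : ℝ) • ((W * (empGram T X)⁻¹) j + b.ofLp) := by
      simp [hq, hr, rowState]
    rw [e1, Matrix.sub_vecMul, Matrix.smul_vecMul, Matrix.add_vecMul, vecMul_mul_inv_row hG, hb,
      hW, proxyGrad_row, vecMul_sum_vecMulVec, ← smul_add, smul_comm, ← smul_sub,
      ← Finset.sum_add_distrib, Finset.smul_sum, ← Finset.sum_sub_distrib]
    congr 1
    refine Finset.sum_congr rfl fun t ht => ?_
    rw [hX t (Finset.mem_range.1 ht), ← add_smul, smul_smul, ← sub_smul]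
    congr 1
    rw [PiLp.add_apply, link_apply, show (A - Astar) j = A j - Astar j from rfl, sub_dotProduct]
    ring
  have hle := (isNormalSolution_of_vecMul hT hqG).norm_le
  have hζ : 0 ≤ 1 - ζ / 2 := by have := hφ.zeta_le_one; linarith
  have hle2 : ‖(WithLp.toLp 2 fun t : Fin T => (A j ⬝ᵥ (X t).ofLp) - (Astar j ⬝ᵥ (X t).ofLp)
        - 1 / 2 * (φ (A j ⬝ᵥ (X t).ofLp) - φ (Astar j ⬝ᵥ (X t).ofLp)) :
          EuclideanSpace ℝ (Fin T))‖
      ≤ (1 - ζ / 2) * ‖design T X (rowState (A - Astar) j)‖ := by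
    refine abs_le_of_sq_le_sq' ?_ (by positivity) |>.2
    rw [mul_pow, EuclideanSpace.norm_sq_eq, EuclideanSpace.norm_sq_eq, Finset.mul_sum]
    refine Finset.sum_le_sum fun t _ => ?_
    rw [← mul_pow]
    refine pow_le_pow_left₀ (norm_nonneg _) ?_ 2
    refine (hφ.abs_sub_half_le _ _).trans_eq ?_
    rw [design_apply, inner_eq_dotProduct, Real.norm_eq_abs,
      dotProduct_comm (X t).ofLp, ← sub_dotProduct]
    rfl
  rw [hstep, map_add, map_smul]
  refine (norm_add_le _ _).trans ?_
  rw [norm_smul]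
  have : ‖(1 / 2 : ℝ)‖ = 1 / 2 := by norm_num
  rw [this]
  linarith

/-- The noise coefficient `1/ζ` is the fixed point of `s ↦ (1 - ζ/2) s + 1/2`, so it survives each
step unchanged. -/
theorem norm_design_quasiNewton_le (hφ : IsExpansiveLink φ ζ) (hT : 0 < T)
    (hG : IsUnit (empGram T X)) (hX : ∀ t < T, X (t + 1) = link φ Astar (X t) + e t)
    (j : Fin d) {b : State d} (hb : Matrix.vecMul b.ofLp (empGram T X)
      = (1 / (T : ℝ)) • ∑ t ∈ Finset.range T, e t j • (X t).ofLp) (m : ℕ) :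
    ‖design T X (rowState (quasiNewton φ (1 / 4) T X m - Astar) j)‖
      ≤ (1 - ζ / 2) ^ m * ‖design T X (rowState Astar j)‖ + 1 / ζ * ‖design T X b‖ := by
  have hζ : 0 ≤ 1 - ζ / 2 := by have := hφ.zeta_le_one; linarith
  have hζ0 := hφ.zeta_pos
  induction m with
  | zero =>
    have : rowState (quasiNewton φ (1 / 4) T X 0 - Astar) j = -rowState Astar j := by
      ext i; simp [quasiNewton, rowState]
    rw [this, map_neg, norm_neg]
    simp only [pow_zero, one_mul]
    have : 0 ≤ 1 / ζ * ‖design T X b‖ := by positivity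
    linarith
  | succ k ih =>
    refine (norm_design_quasiNewton_succ_le hφ hT hG hX j hb k).trans ?_
    have h1 := mul_le_mul_of_nonneg_left ih hζ
    have h2 : (1 - ζ / 2) * (1 / ζ * ‖design T X b‖) + 1 / 2 * ‖design T X b‖
        = 1 / ζ * ‖design T X b‖ := by field_simp; ring
    rw [pow_succ]
    linarith

theorem exists_vecMul_empGram_eq (hG : IsUnit (empGram T X)) (n : Fin d → ℝ) :
    ∃ b : State d, Matrix.vecMul b.ofLp (empGram T X) = n := by
  refine ⟨WithLp.toLp 2 (Matrix.vecMul n (empGram T X)⁻¹), ?_⟩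
  rw [Matrix.vecMul_vecMul, Matrix.nonsing_inv_mul _ ((Matrix.isUnit_iff_isUnit_det _).1 hG),
    Matrix.vecMul_one]

/-- Deterministic error bound for the Quasi-Newton iterates, in terms of the optimization error
`D` and of the size `S` of the least squares projections of the noise. -/
theorem norm_quasiNewton_sub_sq_le (hφ : IsExpansiveLink φ ζ) (hT : 0 < T)
    (hX : ∀ t < T, X (t + 1) = link φ Astar (X t) + e t) {R S : ℝ}
    (hlam : 0 < lambdaMinGram T X) (hR : 0 ≤ R) (hXR : ∀ t < T, ‖X t‖ ≤ R)
    (hS : ∀ (j : Fin d) (b : State d), Matrix.vecMul b.ofLp (empGram T X)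
      = (1 / (T : ℝ)) • ∑ t ∈ Finset.range T, e t j • (X t).ofLp → ‖design T X b‖ ^ 2 ≤ S)
    (m : ℕ) :
    ‖quasiNewton φ (1 / 4) T X m - Astar‖ ^ 2
      ≤ (2 * (Real.exp (-(ζ * m)) * (T * R ^ 2 * ‖Astar‖ ^ 2)) + 2 / ζ ^ 2 * (d * S))
        / (T * lambdaMinGram T X) := by
  have hG := isUnit_empGram hlam
  have hζ0 := hφ.zeta_pos
  have hζ1 := hφ.zeta_le_one
  rw [le_div_iff₀ (by positivity), norm_sq_eq_sum_rowState, Finset.sum_mul]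
  have hrow : ∀ j : Fin d, ‖rowState (quasiNewton φ (1 / 4) T X m - Astar) j‖ ^ 2
      * (T * lambdaMinGram T X)
      ≤ 2 * (Real.exp (-(ζ * m)) * (T * R ^ 2 * ‖rowState Astar j‖ ^ 2)) + 2 / ζ ^ 2 * S := by
    intro j
    obtain ⟨b, hb⟩ := exists_vecMul_empGram_eq hG
      ((1 / (T : ℝ)) • ∑ t ∈ Finset.range T, e t j • (X t).ofLp)
    have h1 := lambdaMinGram_mul_norm_sq_le (X := X) hT
      (rowState (quasiNewton φ (1 / 4) T X m - Astar) j)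
    have h2 := norm_design_quasiNewton_le hφ hT hG hX j hb m
    have h3 := norm_design_le hR hXR (rowState Astar j)
    have hpow : ((1 - ζ / 2) ^ m) ^ 2 ≤ Real.exp (-(ζ * m)) := by
      have h4 : 1 - ζ / 2 ≤ Real.exp (-(ζ / 2)) := Real.one_sub_le_exp_neg _
      calc ((1 - ζ / 2) ^ m) ^ 2 ≤ (Real.exp (-(ζ / 2)) ^ m) ^ 2 := by
            have : 0 ≤ 1 - ζ / 2 := by linarith
            gcongr
        _ = Real.exp (-(ζ * m)) := by
            rw [← Real.exp_nat_mul, ← Real.exp_nat_mul]; push_cast; ring_nf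
    have h5 := pow_le_pow_left₀ (norm_nonneg _) h2 2
    have h6 : ((1 - ζ / 2) ^ m * ‖design T X (rowState Astar j)‖ + 1 / ζ * ‖design T X b‖) ^ 2
        ≤ 2 * (((1 - ζ / 2) ^ m) ^ 2 * ‖design T X (rowState Astar j)‖ ^ 2)
          + 2 * ((1 / ζ) ^ 2 * ‖design T X b‖ ^ 2) := by
      nlinarith [sq_nonneg ((1 - ζ / 2) ^ m * ‖design T X (rowState Astar j)‖
        - 1 / ζ * ‖design T X b‖)]
    have h7 : ((1 - ζ / 2) ^ m) ^ 2 * ‖design T X (rowState Astar j)‖ ^ 2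
        ≤ Real.exp (-(ζ * m)) * (T * R ^ 2 * ‖rowState Astar j‖ ^ 2) := by
      refine mul_le_mul hpow ?_ (by positivity) (Real.exp_pos _).le
      refine (pow_le_pow_left₀ (norm_nonneg _) h3 2).trans_eq ?_
      rw [mul_pow, mul_pow, Real.sq_sqrt (Nat.cast_nonneg T)]
    have h8 : (1 / ζ) ^ 2 * ‖design T X b‖ ^ 2 ≤ (1 / ζ) ^ 2 * S := by
      have := hS j b hb
      gcongr
    have h9 : 2 / ζ ^ 2 * S = 2 * ((1 / ζ) ^ 2 * S) := by ring
    rw [h9]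
    linarith
  refine (Finset.sum_le_sum fun j _ => hrow j).trans_eq ?_
  rw [Finset.sum_add_distrib, norm_sq_eq_sum_rowState]
  simp only [← Finset.mul_sum]
  simp

end QuasiNewton

/-! ### Grids in a cube. -/

section Grid

/-- The points of the cube `[-r, r]^d` whose coordinates are integer multiples of `r / K`. -/
noncomputable def grid (d : ℕ) (r : ℝ) (K : ℕ) : Finset (State d) :=
  (Fintype.piFinset fun _ : Fin d => Finset.Icc (-(K : ℤ)) K).image
    fun k => WithLp.toLp 2 fun i => r / K * (k i : ℝ)

theorem card_grid_le (d : ℕ) (r : ℝ) (K : ℕ) : (grid d r K).card ≤ (2 * K + 1) ^ d := by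
  refine Finset.card_image_le.trans ?_
  rw [Fintype.card_piFinset]
  simp only [Int.card_Icc, Finset.prod_const, Finset.card_univ, Fintype.card_fin]
  gcongr
  omega

theorem exists_mem_grid {d K : ℕ} {r : ℝ} (hK : 0 < K) (hr : 0 < r) {u : State d}
    (hu : ‖u‖ ≤ r) : ∃ u' ∈ grid d r K, ‖u - u'‖ ≤ Real.sqrt d * (r / K) := by
  have hh : 0 < r / K := by positivity
  -- Round each coordinate down to a multiple of `r / K`. Since `±r` are themselves multiples, the
  -- result stays in the cube, and each coordinate moves by a fractional part of the mesh.
  refine ⟨WithLp.toLp 2 fun i => r / K * (⌊u i / (r / K)⌋ : ℝ), ?_, ?_⟩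
  · refine Finset.mem_image.2 ⟨fun i => ⌊u i / (r / K)⌋, ?_, rfl⟩
    refine Fintype.mem_piFinset.2 fun i => ?_
    have h1 : |u i| ≤ r := (PiLp.norm_apply_le u i).trans hu
    have h2 := abs_le.1 h1
    have h3 : r / (r / K) = K := by field_simp
    rw [Finset.mem_Icc]
    constructor
    · rw [Int.le_floor, le_div_iff₀ hh]
      push_cast
      have : -(K : ℝ) * (r / K) = -r := by field_simp
      linarith [h2.1]
    · have h4 : (⌊u i / (r / K)⌋ : ℝ) ≤ K := by
        refine (Int.floor_le _).trans (le_of_le_of_eq ?_ h3)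
        gcongr
        exact h2.2
      exact_mod_cast h4
  · refine abs_le_of_sq_le_sq' ?_ (by positivity) |>.2
    rw [EuclideanSpace.norm_sq_eq, mul_pow, Real.sq_sqrt (Nat.cast_nonneg d)]
    have h1 : ∀ i : Fin d, ‖(u - WithLp.toLp 2 fun i => r / K * (⌊u i / (r / K)⌋ : ℝ)) i‖ ^ 2
        ≤ (r / K) ^ 2 := by
      intro i
      refine pow_le_pow_left₀ (norm_nonneg _) ?_ 2
      have h2 : (u - WithLp.toLp 2 fun i => r / K * (⌊u i / (r / K)⌋ : ℝ)) i
          = r / K * Int.fract (u i / (r / K)) := by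
        rw [Int.fract, mul_sub, mul_div_cancel₀ _ hh.ne']
        rfl
      rw [h2, Real.norm_of_nonneg (mul_nonneg hh.le (Int.fract_nonneg _))]
      exact mul_le_of_le_one_right hh.le (Int.fract_lt_one _).le
    refine (Finset.sum_le_sum fun i _ => h1 i).trans_eq ?_
    simp

end Grid

/-! ### Tail bounds for the noise in a fixed direction. -/

section Noise

variable {Ω : Type*} [MeasurableSpace Ω] {P : Measure Ω} {d T : ℕ} {η : ℕ → Ω → State d}
  {σ v : ℝ}

theorem IsSubGaussianNoise.hasSubgaussianMGF_inner (h : IsSubGaussianNoise P η T v) (hv : 0 ≤ v) {t : ℕ}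
    (ht : t ≤ T) {u : State d} (hu : u ≠ 0) :
    HasSubgaussianMGF (fun ω => inner ℝ (η t ω) u) (v * ‖u‖ ^ 2).toNNReal P := by
  have hu0 : 0 < ‖u‖ := norm_pos_iff.2 hu
  have h1 := (h t ht (‖u‖⁻¹ • u) (by
    rw [norm_smul, norm_inv, norm_norm, inv_mul_cancel₀ hu0.ne'])).const_mul ‖u‖
  have h2 : (fun ω => ‖u‖ * inner ℝ (η t ω) (‖u‖⁻¹ • u)) = fun ω => inner ℝ (η t ω) u := by
    funext ω
    rw [inner_smul_right, mul_inv_cancel_left₀ hu0.ne']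
  rw [h2] at h1
  convert h1 using 1
  ext
  change ((v * ‖u‖ ^ 2).toNNReal : ℝ) = ‖u‖ ^ 2 * (v.toNNReal : ℝ)
  rw [Real.coe_toNNReal _ hv, Real.coe_toNNReal _ (by positivity), mul_comm]

theorem IsSubGaussianNoise.hasSubgaussianMGF_apply (h : IsSubGaussianNoise P η T v) {t : ℕ} (ht : t ≤ T)
    (i : Fin d) : HasSubgaussianMGF (fun ω => η t ω i) v.toNNReal P := by
  have h1 := h t ht (EuclideanSpace.single i 1) (by simp)
  simpa [EuclideanSpace.inner_single_right] using h1

theorem IsNoise.integral_inner_sq [IsProbabilityMeasure P] (hη : IsNoise P η T σ)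
    (h : IsSubGaussianNoise P η T v) {t : ℕ} (ht : t ≤ T) (u : State d) :
    ∫ ω, inner ℝ (η t ω) u ^ 2 ∂P = σ ^ 2 * ‖u‖ ^ 2 := by
  have hL : ∀ i, MemLp (fun ω => η t ω i) 2 P := fun i => (h.hasSubgaussianMGF_apply ht i).memLp 2
  have hint : ∀ i j, Integrable (fun ω => η t ω i * η t ω j) P := fun i j =>
    (hL i).integrable_mul (hL j)
  have h1 : ∀ ω, inner ℝ (η t ω) u ^ 2 = ∑ i, ∑ j, u i * u j * (η t ω i * η t ω j) := by
    intro ω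
    rw [PiLp.inner_apply, sq, Finset.sum_mul_sum]
    refine Finset.sum_congr rfl fun i _ => Finset.sum_congr rfl fun j _ => ?_
    simp
    ring
  simp only [h1]
  rw [integral_finsetSum _ fun i _ => integrable_finsetSum _ fun j _ => (hint i j).const_mul _]
  have h2 : ∀ i, ∫ ω, ∑ j, u i * u j * (η t ω i * η t ω j) ∂P = σ ^ 2 * u i ^ 2 := by
    intro i
    rw [integral_finsetSum _ fun j _ => (hint i j).const_mul _]
    simp only [integral_const_mul, hη.covariance t ht]
    simp
    ring
  simp only [h2, ← Finset.mul_sum, EuclideanSpace.norm_sq_eq, Real.norm_eq_abs, sq_abs]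

/-- The variance proxy of the noise is at least its variance. -/
theorem IsNoise.sq_le_proxy [IsProbabilityMeasure P] (hη : IsNoise P η T σ)
    (h : IsSubGaussianNoise P η T v) (hv : 0 < v) (hd : 0 < d) : σ ^ 2 ≤ v := by
  have h1 := integral_sq_le_of_subgaussian (h.hasSubgaussianMGF_apply (Nat.zero_le T) ⟨0, hd⟩)
    (Real.toNNReal_pos.2 hv)
  rw [Real.coe_toNNReal _ hv.le] at h1
  have h2 := hη.covariance 0 (Nat.zero_le T) ⟨0, hd⟩ ⟨0, hd⟩
  simp only [← sq, if_true] at h2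
  rwa [h2] at h1

theorem IsSubGaussianNoise.measureReal_abs_coord_ge_le [IsProbabilityMeasure P]
    (h : IsSubGaussianNoise P η T v) (hv : 0 ≤ v) {t : ℕ} (ht : t ≤ T) (i : Fin d) {B : ℝ}
    (hB : 0 ≤ B) : P.real {ω | B ≤ |η t ω i|} ≤ 2 * Real.exp (-B ^ 2 / (2 * v)) := by
  have h1 := (h.hasSubgaussianMGF_apply ht i).measure_ge_le hB
  have h2 := (h.hasSubgaussianMGF_apply ht i).neg.measure_ge_le hB
  rw [Real.coe_toNNReal _ hv] at h1 h2
  have h3 : {ω | B ≤ |η t ω i|} ⊆ {ω | B ≤ η t ω i} ∪ {ω | B ≤ (-fun ω => η t ω i) ω} := by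
    intro ω hω
    exact le_abs.1 (show B ≤ |η t ω i| from hω)
  have h4 := (measureReal_mono (μ := P) h3).trans (measureReal_union_le _ _)
  linarith

variable [IsProbabilityMeasure P] {φ : ℝ → ℝ} {A : Mat d}

/-- Tail bound for the self-normalized noise martingale in a fixed direction. -/
theorem measureReal_selfNormalized_ge_le (hη : IsNoise P η T σ)
    (h : IsSubGaussianNoise P η T v) (hv : 0 ≤ v) (hφ : Continuous φ) (i : Fin d) (u : State d)
    (ℓ : ℝ) :
    P.real {ω | ℓ ≤ inner ℝ (WithLp.toLp 2 fun t : Fin T => η t ω i)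
        (design T (trajectory φ A 0 fun t => η t ω) u)
      - v / 2 * ‖design T (trajectory φ A 0 fun t => η t ω) u‖ ^ 2} ≤ Real.exp (-ℓ) := by
  have key := measureReal_sum_ge_le (A := A) hη hφ
    (ψ := fun x e => inner ℝ x u * e i - v / 2 * inner ℝ x u ^ 2) ?_ ?_ (Nat.le_succ T) ℓ
  · convert key using 5 with ω
    rw [inner_design (fun t => η t ω i), norm_design_sq, Finset.mul_sum, Finset.sum_sub_distrib]
  · have h1 : Continuous fun z : State d × State d =>
        inner ℝ z.1 u * z.2 i - v / 2 * inner ℝ z.1 u ^ 2 := by fun_prop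
    exact h1.measurable
  · intro t ht x
    have hsub := h.hasSubgaussianMGF_apply ht i
    have h1 : ∀ ω, Real.exp (inner ℝ x u * η t ω i - v / 2 * inner ℝ x u ^ 2)
        = Real.exp (-(v / 2 * inner ℝ x u ^ 2)) * Real.exp (inner ℝ x u * η t ω i) := by
      intro ω; rw [← Real.exp_add]; ring_nf
    simp only [h1]
    rw [← ofReal_integral_eq_lintegral_ofReal ((hsub.integrable_exp_mul _).const_mul _)
      (Filter.Eventually.of_forall fun ω => by positivity), integral_const_mul,
      ENNReal.ofReal_le_one]
    have h2 := hsub.mgf_le (inner ℝ x u)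
    rw [Real.coe_toNNReal _ hv] at h2
    calc _ ≤ Real.exp (-(v / 2 * inner ℝ x u ^ 2)) * Real.exp (v * inner ℝ x u ^ 2 / 2) := by
          gcongr; exact h2
      _ = 1 := by rw [← Real.exp_add]; ring_nf; exact Real.exp_zero

/-- Lower-tail bound for the empirical second moment in a fixed direction. -/
theorem measureReal_design_sq_le {Cη c₀ : ℝ} (hCη : 0 < Cη) (hσ : 0 < σ)
    (hη : IsNoise P η T σ) (h : IsSubGaussianNoise P η T (Cη * σ ^ 2)) (hφ : Continuous φ)
    (hc₀ : c₀ = 1 / (9600 * (Cη ^ 2 + 1))) (hT : 10 ≤ T) {u : State d}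
    (hu1 : 31 / 32 ≤ ‖u‖) (hu2 : ‖u‖ ≤ 33 / 32) :
    P.real {ω | ‖design T (trajectory φ A 0 fun t => η t ω) u‖ ^ 2 ≤ 2 / 3 * σ ^ 2 * T}
      ≤ Real.exp (-(c₀ * T / 10)) := by
  have hu0 : u ≠ 0 := by rintro rfl; norm_num at hu1
  have hc₀0 : 0 < c₀ := by rw [hc₀]; positivity
  have hn1 : 15 / 16 ≤ ‖u‖ ^ 2 := by nlinarith
  have hn2 : ‖u‖ ^ 2 ≤ 17 / 16 + 1 / 100 := by nlinarith [norm_nonneg u]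
  have hcC : c₀ * (Cη ^ 2 + 1) = 1 / 9600 := by rw [hc₀]; field_simp
  -- With `λ = c₀ / σ²` the mean of the square contributes at least `(15/16) c₀`, and the
  -- fourth-moment error is at most `96 * 2 / 9600 = 1/50` of `c₀`. What remains exceeds the
  -- compensator `(9/10) c₀`.
  have hmean : ∀ t ≤ T, ∀ x, ∫⁻ ω, ENNReal.ofReal (Real.exp
      (9 / 10 * c₀ - c₀ / σ ^ 2 * inner ℝ (link φ A x + η t ω) u ^ 2)) ∂P ≤ 1 := by
    intro t ht x
    have hv : 0 < Cη * σ ^ 2 * ‖u‖ ^ 2 := by positivity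
    have hsub := h.hasSubgaussianMGF_inner (by positivity) ht hu0
    have h1 := integral_exp_neg_sq_le hsub (Real.toNNReal_pos.2 hv) (lam := c₀ / σ ^ 2)
      (by positivity) (by
        rw [Real.coe_toNNReal _ hv.le]
        have : 4 * (c₀ / σ ^ 2) * (Cη * σ ^ 2 * ‖u‖ ^ 2) = 4 * (c₀ * Cη) * ‖u‖ ^ 2 := by
          field_simp
        rw [this]
        have h2 : c₀ * Cη ≤ 1 / 9600 := by
          rw [← hcC]; gcongr; nlinarith [sq_nonneg (Cη - 1)]
        nlinarith [mul_pos hc₀0 hCη]) (inner ℝ (link φ A x) u)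
    rw [hη.integral_inner_sq h ht, Real.coe_toNNReal _ hv.le] at h1
    have hexp : ∀ ω, Real.exp (9 / 10 * c₀ - c₀ / σ ^ 2 * inner ℝ (link φ A x + η t ω) u ^ 2)
        = Real.exp (9 / 10 * c₀) * Real.exp (-(c₀ / σ ^ 2 *
          (inner ℝ (link φ A x) u + inner ℝ (η t ω) u) ^ 2)) := by
      intro ω; rw [← Real.exp_add, inner_add_left]; ring_nf
    simp only [hexp]
    have hint : Integrable (fun ω => Real.exp (-(c₀ / σ ^ 2 *
          (inner ℝ (link φ A x) u + inner ℝ (η t ω) u) ^ 2))) P := by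
      refine Integrable.of_bound (C := 1) ?_ (Filter.Eventually.of_forall fun ω => ?_)
      · have hm := hsub.aestronglyMeasurable
        have hcont : Continuous fun y : ℝ => Real.exp (-(c₀ / σ ^ 2 *
          (inner ℝ (link φ A x) u + y) ^ 2)) := by fun_prop
        exact hcont.comp_aestronglyMeasurable hm
      · rw [Real.norm_of_nonneg (Real.exp_pos _).le]
        refine Real.exp_le_one_iff.2 (neg_nonpos.2 (by positivity))
    rw [← ofReal_integral_eq_lintegral_ofReal (hint.const_mul _)
      (Filter.Eventually.of_forall fun ω => by positivity), integral_const_mul,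
      ENNReal.ofReal_le_one]
    calc _ ≤ Real.exp (9 / 10 * c₀) * _ := mul_le_mul_of_nonneg_left h1 (Real.exp_pos _).le
      _ ≤ 1 := by
        rw [← Real.exp_add]
        refine Real.exp_le_one_iff.2 ?_
        have e1 : c₀ / σ ^ 2 * (σ ^ 2 * ‖u‖ ^ 2) = c₀ * ‖u‖ ^ 2 := by field_simp
        have e2 : 96 * (c₀ / σ ^ 2) ^ 2 * (Cη * σ ^ 2 * ‖u‖ ^ 2) ^ 2
            = c₀ * (96 * (c₀ * Cη ^ 2) * (‖u‖ ^ 2) ^ 2) := by field_simp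
        rw [e1, e2]
        have e3 : c₀ * Cη ^ 2 ≤ 1 / 9600 := by nlinarith
        have e4 : (‖u‖ ^ 2) ^ 2 ≤ 2 := by nlinarith
        have e5 : 96 * (c₀ * Cη ^ 2) * (‖u‖ ^ 2) ^ 2 ≤ 96 * (1 / 9600) * 2 := by gcongr
        nlinarith
  -- The state `X_0 = 0` contributes nothing and `X_{s+1}` is paired with `η s`, so only `T - 1`
  -- terms enter. For `T ≥ 10`, `(9/10)(T - 1) - (2/3) T ≥ T / 10`.
  have key := measureReal_sum_ge_le (A := A) hη hφ
    (ψ := fun x e => 9 / 10 * c₀ - c₀ / σ ^ 2 * inner ℝ (link φ A x + e) u ^ 2) (by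
      have hc := continuous_link (A := A) hφ
      have h1 : Continuous fun z : State d × State d =>
        9 / 10 * c₀ - c₀ / σ ^ 2 * inner ℝ (link φ A z.1 + z.2) u ^ 2 := by fun_prop
      exact h1.measurable) hmean (t := T - 1) (by omega) (c₀ * T / 10)
  refine le_trans (measureReal_mono fun ω hω => ?_) key
  simp only [Set.mem_ofPred_eq] at hω ⊢
  obtain ⟨n, rfl⟩ : ∃ n, T = n + 1 := ⟨T - 1, by omega⟩
  rw [norm_design_sq, Finset.sum_range_succ'] at hω
  simp only [trajectory, inner_zero_left] at hω
  rw [Finset.sum_sub_distrib, Finset.sum_const, nsmul_eq_mul, ← Finset.mul_sum,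
    Nat.add_sub_cancel, Finset.card_range]
  have hn : (9 : ℝ) ≤ n := by exact_mod_cast (by omega : 9 ≤ n)
  have h2 : c₀ / σ ^ 2 * ∑ s ∈ Finset.range n, inner ℝ (link φ A
      (trajectory φ A 0 (fun t => η t ω) s) + η s ω) u ^ 2 ≤ c₀ * (2 / 3 * (n + 1)) := by
    rw [div_mul_eq_mul_div, div_le_iff₀ (by positivity)]
    push_cast at hω
    nlinarith
  push_cast
  nlinarith

end Noise

/-! ### From the grid to all directions. -/

section Main

variable {d T : ℕ} {X : ℕ → State d} {σ : ℝ}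

/-- If the empirical second moment is large on a fine grid and the states are bounded, then the
smallest eigenvalue of the empirical second moment matrix is at least `σ² / 2`. -/
theorem half_sq_le_lambdaMinGram (hd : 0 < d) (hT : 0 < T) {K : ℕ} {R : ℝ}
    (hK : 0 < K) (hKd : 32 * Real.sqrt d ≤ K) (hR : 0 ≤ R) (hXR : ∀ t < T, ‖X t‖ ≤ R)
    (hRK : (R * (Real.sqrt d / K)) ^ 2 ≤ σ ^ 2 / 128)
    (hgrid : ∀ u ∈ grid d 1 K, 31 / 32 ≤ ‖u‖ → ‖u‖ ≤ 33 / 32 →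
      2 / 3 * σ ^ 2 * T < ‖design T X u‖ ^ 2) : σ ^ 2 / 2 ≤ lambdaMinGram T X := by
  refine le_lambdaMinGram hd hT fun u hu => ?_
  obtain ⟨u', hu'mem, hu'⟩ := exists_mem_grid hK one_pos hu.le
  have hK' : (0 : ℝ) < K := by exact_mod_cast hK
  have hε : Real.sqrt d * (1 / K) ≤ 1 / 32 := by
    rw [mul_one_div, div_le_iff₀ hK']; linarith
  have h1 := abs_le.1 ((abs_norm_sub_norm_le u u').trans (hu'.trans hε))
  rw [hu] at h1
  have h2 := hgrid u' hu'mem (by linarith) (by linarith)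
  have h3 : ‖design T X u'‖ ≤ ‖design T X u‖ + Real.sqrt T * (R * (Real.sqrt d / K)) := by
    have h4 := norm_design_le hR hXR (u' - u)
    rw [map_sub] at h4
    have h5 := norm_add_le (design T X u) (design T X u' - design T X u)
    rw [add_sub_cancel] at h5
    rw [norm_sub_rev u' u] at h4
    have h6 : Real.sqrt T * R * ‖u - u'‖ ≤ Real.sqrt T * R * (Real.sqrt d * (1 / K)) := by gcongr
    rw [mul_one_div, mul_assoc (Real.sqrt T) R (Real.sqrt d / K)] at h6
    linarith
  have h4 : (Real.sqrt T * (R * (Real.sqrt d / K))) ^ 2 ≤ T * (σ ^ 2 / 128) := by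
    rw [mul_pow, Real.sq_sqrt (Nat.cast_nonneg T)]
    gcongr
  have h5 := pow_le_pow_left₀ (norm_nonneg _) h3 2
  set y := ‖design T X u‖
  set z := Real.sqrt T * (R * (Real.sqrt d / K))
  -- The square gives `(y + z)² ≤ (9/8) y² + 9 z²`, and `(8/9)(2/3 - 9/128) > 1/2`.
  nlinarith [sq_nonneg (y - 8 * z)]

/-- If the self-normalized process of `g` is below `ℓ` on a fine grid, then the least squares
projection of `g` on the data is of size `√(6 v ℓ)`. -/
theorem norm_design_sq_le_of_grid (hT : 0 < T) (hσ : 0 < σ) {K : ℕ} {R v ℓ : ℝ} (hK : 0 < K)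
    (hR : 0 ≤ R) (hXR : ∀ t < T, ‖X t‖ ≤ R)
    (hRK : (R * (Real.sqrt d / K)) ^ 2 ≤ σ ^ 2 / 128) (hv : 0 < v) (hℓ : 0 < ℓ)
    (hlam : σ ^ 2 / 2 ≤ lambdaMinGram T X) {g : ℕ → ℝ}
    (hgrid : ∀ u ∈ grid d (Real.sqrt (6 * v * ℓ) / (v * Real.sqrt (T * (σ ^ 2 / 2)))) K,
      inner ℝ (WithLp.toLp 2 fun t : Fin T => g t) (design T X u)
        - v / 2 * ‖design T X u‖ ^ 2 < ℓ)
    {b : State d} (hb : Matrix.vecMul b.ofLp (empGram T X)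
      = (1 / (T : ℝ)) • ∑ t ∈ Finset.range T, g t • (X t).ofLp) :
    ‖design T X b‖ ^ 2 ≤ 6 * v * ℓ := by
  have hT' : (0 : ℝ) < T := by exact_mod_cast hT
  have hK' : (0 : ℝ) < K := by exact_mod_cast hK
  set β := Real.sqrt (6 * v * ℓ) with hβ
  set τ := (T : ℝ) * (σ ^ 2 / 2) with hτ
  have hτ0 : 0 < τ := by positivity
  have hβ0 : 0 < β := Real.sqrt_pos.2 (by positivity)
  have hsτ : 0 < Real.sqrt τ := Real.sqrt_pos.2 hτ0
  set r := β / (v * Real.sqrt τ) with hr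
  have hr0 : 0 < r := by positivity
  have hβsq : β ^ 2 = 6 * v * ℓ := Real.sq_sqrt (by positivity)
  rw [← hβsq]
  refine pow_le_pow_left₀ (norm_nonneg _) ?_ 2
  refine (isNormalSolution_of_vecMul hT hb).norm_le_of_net (M := Real.sqrt T * R) (τ := τ)
    (ε := Real.sqrt d * (r / K)) (r := r) (ℓ := ℓ) (N := grid d r K) hv hτ0 hβ0 ?_
    (norm_design_le hR hXR) (by positivity) ?_ ?_ (fun u hu => exists_mem_grid hK hr0 hu) hgrid ?_
  · intro w
    refine le_trans ?_ (lambdaMinGram_mul_norm_sq_le hT w)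
    rw [hτ]
    gcongr
  · rw [hr, div_mul_cancel₀ _ (by positivity)]
  · have h1 : Real.sqrt T * (R * (Real.sqrt d / K)) ≤ Real.sqrt τ / 8 := by
      refine abs_le_of_sq_le_sq' ?_ (by positivity) |>.2
      rw [mul_pow, div_pow, Real.sq_sqrt hT'.le, Real.sq_sqrt hτ0.le, hτ]
      nlinarith
    calc Real.sqrt T * R * (Real.sqrt d * (r / K))
        = Real.sqrt T * (R * (Real.sqrt d / K)) * r := by ring
      _ ≤ Real.sqrt τ / 8 * r := by gcongr
      _ = β / (8 * v) := by rw [hr]; field_simp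
  · rw [hβsq]; nlinarith [mul_pos hv hℓ]

end Main

/-! ### Union bounds for the three bad events. -/

section Events

variable {Ω : Type*} [MeasurableSpace Ω] {P : Measure Ω} [IsProbabilityMeasure P] {d T : ℕ}
  {η : ℕ → Ω → State d} {σ v δ : ℝ} {φ : ℝ → ℝ} {A : Mat d}

theorem measureReal_exists_coord_ge_le (h : IsSubGaussianNoise P η T v) (hv : 0 < v)
    (hd : 0 < d) (hT : 0 < T) (hδ : 0 < δ) (hδ1 : δ ≤ 1) :
    P.real {ω | ∃ t < T, ∃ i, Real.sqrt (2 * v * Real.log (4 * T * d / δ)) ≤ |η t ω i|}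
      ≤ δ / 2 := by
  have hT' : (1 : ℝ) ≤ T := by exact_mod_cast hT
  have hd' : (1 : ℝ) ≤ d := by exact_mod_cast hd
  have hlog : 0 ≤ Real.log (4 * T * d / δ) := by
    refine Real.log_nonneg ?_
    rw [le_div_iff₀ hδ]
    nlinarith
  set B := Real.sqrt (2 * v * Real.log (4 * T * d / δ)) with hB
  have hsub : {ω | ∃ t < T, ∃ i, B ≤ |η t ω i|}
      ⊆ ⋃ p ∈ Finset.range T ×ˢ (Finset.univ : Finset (Fin d)), {ω | B ≤ |η p.1 ω p.2|} := by
    rintro ω ⟨t, ht, i, hi⟩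
    exact Set.mem_biUnion (x := (t, i)) (by simpa using ht) hi
  -- The level `B` is chosen so that `T d` two-sided tails add up to `δ / 2`.
  have hone : Real.exp (-B ^ 2 / (2 * v)) = δ / (4 * T * d) := by
    rw [hB, Real.sq_sqrt (by positivity), ← mul_neg, mul_div_cancel_left₀ _ (by positivity),
      Real.exp_neg, Real.exp_log (by positivity), inv_div]
  refine (measureReal_mono hsub (measure_ne_top _ _)).trans ((measureReal_biUnion_finset_le _ _).trans ?_)
  calc _ ≤ ∑ p ∈ Finset.range T ×ˢ (Finset.univ : Finset (Fin d)), 2 * (δ / (4 * T * d)) := by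
        refine Finset.sum_le_sum fun p hp => ?_
        have hp1 := Finset.mem_range.1 (Finset.mem_product.1 hp).1
        have := h.measureReal_abs_coord_ge_le hv.le hp1.le p.2 (Real.sqrt_nonneg
          (2 * v * Real.log (4 * T * d / δ)))
        rwa [← hB, hone] at this
    _ = δ / 2 := by
        rw [Finset.sum_const, Finset.card_product, Finset.card_range, Finset.card_univ,
          Fintype.card_fin, nsmul_eq_mul]
        push_cast
        field_simp
        norm_num

theorem measureReal_exists_grid_design_sq_le {Cη c₀ r : ℝ} {K : ℕ} (hCη : 0 < Cη) (hσ : 0 < σ)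
    (hη : IsNoise P η T σ) (h : IsSubGaussianNoise P η T (Cη * σ ^ 2)) (hφ : Continuous φ)
    (hc₀ : c₀ = 1 / (9600 * (Cη ^ 2 + 1))) (hT : 10 ≤ T) (hδ : 0 < δ)
    (hlarge : d * Real.log (2 * K + 1) + Real.log (4 / δ) ≤ c₀ * T / 10) :
    P.real {ω | ∃ u ∈ grid d r K, 31 / 32 ≤ ‖u‖ ∧ ‖u‖ ≤ 33 / 32 ∧
      ‖design T (trajectory φ A 0 fun t => η t ω) u‖ ^ 2 ≤ 2 / 3 * σ ^ 2 * T} ≤ δ / 4 := by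
  have hsub : {ω | ∃ u ∈ grid d r K, 31 / 32 ≤ ‖u‖ ∧ ‖u‖ ≤ 33 / 32 ∧
      ‖design T (trajectory φ A 0 fun t => η t ω) u‖ ^ 2 ≤ 2 / 3 * σ ^ 2 * T}
      ⊆ ⋃ u ∈ (grid d r K).filter fun u => 31 / 32 ≤ ‖u‖ ∧ ‖u‖ ≤ 33 / 32,
        {ω | ‖design T (trajectory φ A 0 fun t => η t ω) u‖ ^ 2 ≤ 2 / 3 * σ ^ 2 * T} := by
    rintro ω ⟨u, hu, hu1, hu2, hu3⟩
    exact Set.mem_biUnion (Finset.mem_coe.2 (Finset.mem_filter.2 ⟨hu, hu1, hu2⟩)) hu3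
  refine (measureReal_mono hsub (measure_ne_top _ _)).trans ((measureReal_biUnion_finset_le _ _).trans ?_)
  refine (Finset.sum_le_card_nsmul _ _ (Real.exp (-(c₀ * T / 10))) fun u hu => ?_).trans ?_
  · have hu' := (Finset.mem_filter.1 hu).2
    exact measureReal_design_sq_le hCη hσ hη h hφ hc₀ hT hu'.1 hu'.2
  · have hcard : (((grid d r K).filter fun u => 31 / 32 ≤ ‖u‖ ∧ ‖u‖ ≤ 33 / 32).card : ℝ)
        ≤ (2 * K + 1) ^ d := by
      exact_mod_cast (Finset.card_filter_le _ _).trans (card_grid_le d r K)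
    rw [nsmul_eq_mul]
    calc _ ≤ (2 * (K : ℝ) + 1) ^ d * Real.exp (-(c₀ * T / 10)) := by gcongr
      _ ≤ (2 * (K : ℝ) + 1) ^ d
          * Real.exp (-(d * Real.log (2 * K + 1) + Real.log (4 / δ))) := by gcongr
      _ = δ / 4 := by
        rw [neg_add, Real.exp_add, Real.exp_neg, Real.exp_neg, Real.exp_nat_mul,
          Real.exp_log (by positivity), Real.exp_log (by positivity)]
        field_simp

theorem measureReal_exists_grid_selfNormalized_ge_le {r : ℝ} {K : ℕ} (hη : IsNoise P η T σ)
    (h : IsSubGaussianNoise P η T v) (hv : 0 ≤ v) (hφ : Continuous φ) (hd : 0 < d)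
    (hδ : 0 < δ) :
    P.real {ω | ∃ i, ∃ u ∈ grid d r K, d * Real.log (2 * K + 1) + Real.log (4 * d / δ) ≤
        inner ℝ (WithLp.toLp 2 fun t : Fin T => η t ω i)
          (design T (trajectory φ A 0 fun t => η t ω) u)
        - v / 2 * ‖design T (trajectory φ A 0 fun t => η t ω) u‖ ^ 2} ≤ δ / 4 := by
  set ℓ := d * Real.log (2 * K + 1) + Real.log (4 * d / δ) with hℓ
  have hsub : {ω | ∃ i, ∃ u ∈ grid d r K, ℓ ≤
        inner ℝ (WithLp.toLp 2 fun t : Fin T => η t ω i)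
          (design T (trajectory φ A 0 fun t => η t ω) u)
        - v / 2 * ‖design T (trajectory φ A 0 fun t => η t ω) u‖ ^ 2}
      ⊆ ⋃ p ∈ (Finset.univ : Finset (Fin d)) ×ˢ grid d r K, {ω | ℓ ≤
        inner ℝ (WithLp.toLp 2 fun t : Fin T => η t ω p.1)
          (design T (trajectory φ A 0 fun t => η t ω) p.2)
        - v / 2 * ‖design T (trajectory φ A 0 fun t => η t ω) p.2‖ ^ 2} := by
    rintro ω ⟨i, u, hu, hle⟩
    exact Set.mem_biUnion (x := (i, u)) (by simpa using hu) hle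
  refine (measureReal_mono hsub (measure_ne_top _ _)).trans ((measureReal_biUnion_finset_le _ _).trans ?_)
  refine (Finset.sum_le_card_nsmul _ _ (Real.exp (-ℓ)) fun p _ =>
    measureReal_selfNormalized_ge_le hη h hv hφ p.1 p.2 ℓ).trans ?_
  have hd' : (0 : ℝ) < d := by exact_mod_cast hd
  have hcard : ((grid d r K).card : ℝ) ≤ (2 * K + 1) ^ d := by
    exact_mod_cast card_grid_le d r K
  rw [nsmul_eq_mul, Finset.card_product, Finset.card_univ, Fintype.card_fin]
  push_cast
  calc _ ≤ d * (2 * (K : ℝ) + 1) ^ d * Real.exp (-ℓ) := by gcongr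
    _ = δ / 4 := by
      rw [hℓ, neg_add, Real.exp_add, Real.exp_neg, Real.exp_neg, Real.exp_nat_mul,
        Real.exp_log (by positivity), Real.exp_log (by positivity)]
      field_simp

end Events

/-- At `k = 0` the two states have not moved, so any nonzero difference forces this; positivity of
the dimension supplies one. -/
theorem IsExpRegular.one_le {d : ℕ} {φ : ℝ → ℝ} {A : Mat d} {C ρ : ℝ}
    (h : IsExpRegular φ A C ρ) (hd : 0 < d) : 1 ≤ C := by
  have h1 := h 0 (EuclideanSpace.single ⟨0, hd⟩ 1) 0 fun _ => 0
  simpa [trajectory] using h1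

theorem IsExpRegular.rate_nonneg {d : ℕ} {φ : ℝ → ℝ} {A : Mat d} {C ρ : ℝ}
    (h : IsExpRegular φ A C ρ) (hd : 0 < d) : 0 ≤ ρ := by
  have h1 := (norm_nonneg _).trans (h 1 (EuclideanSpace.single ⟨0, hd⟩ 1) 0 fun _ => 0)
  have hC := h.one_le hd
  simp only [pow_one, sub_zero, PiLp.norm_single, norm_one, mul_one] at h1
  exact nonneg_of_mul_nonneg_right h1 (by linarith)

/-- The logarithm is at least `log 8 > 2` and the remaining constants are at least one. With this
bound, dimension factors in the mesh are absorbed into `R* / σ²`. -/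
theorem two_mul_dim_mul_sq_le_Rstar {d T : ℕ} {Cη σ Cρ ρ δ : ℝ} (hd : 0 < d) (hT : 0 < T)
    (hδ0 : 0 < δ) (hδ : δ < 1 / 2) (hCη : 1 ≤ Cη) (hCρ : 1 ≤ Cρ) (hρ : 0 ≤ ρ) :
    2 * d * σ ^ 2 ≤ Rstar d T Cη σ Cρ ρ δ := by
  have hT' : (1 : ℝ) ≤ T := by exact_mod_cast hT
  have hd' : (1 : ℝ) ≤ d := by exact_mod_cast hd
  have hsum : 1 ≤ ∑ t ∈ Finset.range T, ρ ^ t := by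
    have := Finset.single_le_sum (f := fun t => ρ ^ t) (s := Finset.range T)
      (fun t _ => by positivity) (Finset.mem_range.2 hT)
    simpa using this
  have hlog : 2 ≤ Real.log (4 * T * d / δ) := by
    have h1 : (2 : ℝ) ^ 3 ≤ 4 * T * d / δ := by
      rw [le_div_iff₀ hδ0]
      nlinarith
    have h2 := Real.log_le_log (by positivity) h1
    rw [Real.log_pow] at h2
    have := Real.log_two_gt_d9
    push_cast at h2
    linarith
  have h1 : (1 : ℝ) ≤ Cρ ^ 2 := one_le_pow₀ hCρ
  have h2 : (1 : ℝ) ≤ (∑ t ∈ Finset.range T, ρ ^ t) ^ 2 := one_le_pow₀ hsum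
  calc 2 * d * σ ^ 2 = 1 * 1 * d * σ ^ 2 * 1 * 2 := by ring
    _ ≤ _ := by unfold Rstar; gcongr

theorem exp_neg_mul_mul_le_one {ζ x : ℝ} {m : ℕ} (hζ : 0 < ζ) (hx : 0 ≤ x)
    (h : 10 / ζ * Real.log x ≤ m) : Real.exp (-(ζ * m)) * x ≤ 1 := by
  -- The case `x = 0` is `A* = A_0`: there `log 0 = 0` makes the iteration requirement vacuous, and
  -- the product vanishes.
  rcases hx.eq_or_lt with rfl | hx0
  · simp
  have hm : 0 ≤ ζ * m := by positivity
  have h1 : 10 * Real.log x ≤ ζ * m := by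
    have h2 := mul_le_mul_of_nonneg_left h hζ.le
    have h3 : ζ * (10 / ζ * Real.log x) = 10 * Real.log x := by field_simp
    linarith
  have h2 : Real.log x ≤ ζ * m := by
    rcases le_total (Real.log x) 0 with h0 | h0 <;> linarith
  calc Real.exp (-(ζ * m)) * x = Real.exp (-(ζ * m)) * Real.exp (Real.log x) := by
        rw [Real.exp_log hx0]
    _ = Real.exp (Real.log x - ζ * m) := by rw [← Real.exp_add]; ring_nf
    _ ≤ 1 := Real.exp_le_one_iff.2 (by linarith)

/-- For `L ≥ 2` one has `2 ⌈16 L⌉ + 1 ≤ 32 L + 3 ≤ 2^6 L ≤ L^7`. The grid resolution thus costs only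
a multiple of `log L`. -/
theorem log_two_mul_ceil_le {L : ℝ} (hL : 2 ≤ L) :
    Real.log (2 * (⌈16 * L⌉₊ : ℝ) + 1) ≤ 7 * Real.log L := by
  have h1 := (Nat.ceil_lt_add_one (a := 16 * L) (by linarith)).le
  have h2 : 2 * (⌈16 * L⌉₊ : ℝ) + 1 ≤ L ^ 7 := by
    have h3 : (2 : ℝ) ^ 6 * L ≤ L ^ 6 * L := by gcongr
    have h4 : L ^ 7 = L ^ 6 * L := by ring
    rw [h4]
    linarith
  have h3 := Real.log_le_log (by positivity) h2
  rw [Real.log_pow] at h3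
  exact_mod_cast h3

theorem sq_mul_sqrt_div_le {d K : ℕ} {L R σ : ℝ} (hR : R ^ 2 = 2 * (L * σ ^ 2))
    (hLd : 2 * d ≤ L) (hKL : 16 * L ≤ K) (hK : (0 : ℝ) < K) :
    (R * (Real.sqrt d / K)) ^ 2 ≤ σ ^ 2 / 128 := by
  have hL : 0 ≤ L := le_trans (by positivity) hLd
  rw [mul_pow, div_pow, Real.sq_sqrt (by positivity), hR, mul_div_assoc',
    div_le_iff₀ (by positivity)]
  have h1 : (16 * L) ^ 2 ≤ (K : ℝ) ^ 2 := by gcongr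
  have h2 : σ ^ 2 / 128 * (16 * L) ^ 2 ≤ σ ^ 2 / 128 * (K : ℝ) ^ 2 := by gcongr
  have h3 : σ ^ 2 * L * (2 * d) ≤ σ ^ 2 * L * L := by gcongr
  have h4 : 0 ≤ σ ^ 2 * L * L := by positivity
  linarith

/-- The iteration count brings the optimization error down to order `σ² d²`, which the `d²` term
absorbs because `log (1 + L) ≥ 1`; this gives the `4`. The noise part gives `84 = 2 * 6 * 7`. -/
theorem norm_quasiNewton_sub_sq_le_of_bounds {d T m K : ℕ} {φ : ℝ → ℝ} {Astar : Mat d}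
    {X e : ℕ → State d} {ζ σ δ Cη Rs R : ℝ} (hd : 0 < d) (hT : 0 < T) (hσ : 0 < σ)
    (hδ0 : 0 < δ) (hδ : δ < 1 / 2) (hCη : 0 < Cη) (hφ : IsExpansiveLink φ ζ)
    (hX : ∀ t < T, X (t + 1) = link φ Astar (X t) + e t) (hlam0 : 0 < lambdaMinGram T X)
    (hR0 : 0 ≤ R) (hXR : ∀ t < T, ‖X t‖ ≤ R) (hRsq : R ^ 2 = 2 * Rs) (hL2 : 2 ≤ Rs / σ ^ 2)
    (hm : 10 / ζ * Real.log (‖(0 : Mat d) - Astar‖ ^ 2 * (T * Rs) / (σ ^ 2 * (d : ℝ) ^ 2)) ≤ m)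
    (hS : ∀ (j : Fin d) (b : State d), Matrix.vecMul b.ofLp (empGram T X)
      = (1 / (T : ℝ)) • ∑ t ∈ Finset.range T, e t j • (X t).ofLp → ‖design T X b‖ ^ 2
        ≤ 6 * (Cη * σ ^ 2) * (d * Real.log (2 * K + 1) + Real.log (4 * d / δ)))
    (hlogK : Real.log (2 * K + 1) ≤ 7 * Real.log (Rs / σ ^ 2)) :
    ‖quasiNewton φ (1 / 4) T X m - Astar‖ ^ 2
      ≤ (4 + 84 * Cη) * σ ^ 2 / (T * ζ ^ 2 * lambdaMinGram T X)
        * ((d : ℝ) ^ 2 * Real.log (1 + Rs / σ ^ 2) + d * Real.log (2 * d / δ)) := by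
  have hd' : (1 : ℝ) ≤ d := by exact_mod_cast hd
  have hRs0 : 0 ≤ Rs := by nlinarith [sq_nonneg R]
  set L := Rs / σ ^ 2 with hL
  set v := Cη * σ ^ 2 with hv
  set ℓ := d * Real.log (2 * K + 1) + Real.log (4 * d / δ) with hℓ
  refine (norm_quasiNewton_sub_sq_le hφ hT hX hlam0 hR0 hXR hS m).trans ?_
  have hζ0 := hφ.zeta_pos
  have hζ1 := hφ.zeta_le_one
  have hopt : Real.exp (-(ζ * m)) * (T * R ^ 2 * ‖Astar‖ ^ 2) ≤ 2 * σ ^ 2 * d ^ 2 := by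
    have h4 := exp_neg_mul_mul_le_one hζ0 (by positivity) hm
    rw [zero_sub, norm_neg, ← mul_div_assoc, div_le_one (by positivity)] at h4
    rw [hRsq]
    linarith
  have hlog1 : 1 ≤ Real.log (1 + L) := by
    rw [Real.le_log_iff_exp_le (by linarith)]
    have := Real.exp_one_lt_d9
    linarith
  have hℓle : ℓ ≤ 7 * (d * Real.log (1 + L) + Real.log (2 * d / δ)) := by
    have h5 : Real.log L ≤ Real.log (1 + L) := Real.log_le_log (by linarith) (by linarith)
    have h6 : Real.log (2 * K + 1) ≤ 7 * Real.log (1 + L) := by linarith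
    have h7 : d * Real.log (2 * K + 1) ≤ d * (7 * Real.log (1 + L)) := by gcongr
    have h8 : Real.log 2 ≤ Real.log (2 * d / δ) := by
      refine Real.log_le_log (by norm_num) ?_
      rw [le_div_iff₀ hδ0]; linarith
    have h9 : Real.log (4 * d / δ) = Real.log 2 + Real.log (2 * d / δ) := by
      rw [← Real.log_mul (by norm_num) (by positivity)]
      ring_nf
    rw [hℓ, h9]
    linarith [Real.log_two_gt_d9]
  set Y := (d : ℝ) ^ 2 * Real.log (1 + L) + d * Real.log (2 * d / δ) with hY
  have hdY : (d : ℝ) ^ 2 ≤ Y := by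
    have h5 : 0 ≤ d * Real.log (2 * d / δ) := by
      refine mul_nonneg (by positivity) (Real.log_nonneg ?_)
      rw [le_div_iff₀ hδ0]; linarith
    have h6 : (d : ℝ) ^ 2 * 1 ≤ (d : ℝ) ^ 2 * Real.log (1 + L) := by gcongr
    linarith
  have hdl : d * ℓ ≤ 7 * Y := by
    have h5 : d * ℓ ≤ d * (7 * (d * Real.log (1 + L) + Real.log (2 * d / δ))) := by gcongr
    refine h5.trans_eq ?_
    rw [hY]; ring
  have hnum : 2 * (Real.exp (-(ζ * m)) * (T * R ^ 2 * ‖Astar‖ ^ 2))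
      + 2 / ζ ^ 2 * (d * (6 * v * ℓ)) ≤ (4 + 84 * Cη) * σ ^ 2 * Y / ζ ^ 2 := by
    have h5 : 2 / ζ ^ 2 * (d * (6 * v * ℓ)) ≤ 84 * Cη * σ ^ 2 * Y / ζ ^ 2 := by
      rw [div_mul_eq_mul_div]
      refine div_le_div_of_nonneg_right ?_ (by positivity)
      have h6 : 12 * v * (d * ℓ) ≤ 12 * v * (7 * Y) := by gcongr
      rw [hv] at h6 ⊢
      linarith
    have h7 : 4 * σ ^ 2 * d ^ 2 ≤ 4 * σ ^ 2 * Y / ζ ^ 2 := by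
      have hY0 : 0 ≤ Y := le_trans (by positivity) hdY
      rw [le_div_iff₀ (by positivity)]
      have h8 : ζ ^ 2 ≤ 1 := pow_le_one₀ hζ0.le hζ1
      calc 4 * σ ^ 2 * d ^ 2 * ζ ^ 2 ≤ 4 * σ ^ 2 * Y * 1 := by gcongr
        _ = _ := mul_one _
    have h9 : (4 + 84 * Cη) * σ ^ 2 * Y / ζ ^ 2
        = 4 * σ ^ 2 * Y / ζ ^ 2 + 84 * Cη * σ ^ 2 * Y / ζ ^ 2 := by ring
    rw [h9]
    linarith
  calc _ ≤ ((4 + 84 * Cη) * σ ^ 2 * Y / ζ ^ 2) / (T * lambdaMinGram T X) := by gcongr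
    _ = _ := by field_simp

end NLDS

/-! ### Choice of constants and assembly. -/

theorem theorem1 (Cη : ℝ) (hCη : 0 < Cη) :
    ∃ Cbar Cbar₃ : ℝ, 0 < Cbar ∧ 0 < Cbar₃ ∧
      ∀ {Ω : Type*} [MeasurableSpace Ω] (P : Measure Ω) [IsProbabilityMeasure P]
        (d T m : ℕ) (φ : ℝ → ℝ) (Astar : NLDS.Mat d) (η : ℕ → Ω → NLDS.State d)
        (ζ σ Cρ ρ δ : ℝ),
        0 < d → 0 < σ → 0 < δ → δ < 1 / 2 →
        NLDS.IsExpansiveLink φ ζ →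
        NLDS.IsNoise P η T σ →
        NLDS.IsSubGaussianNoise P η T (Cη * σ ^ 2) →
        NLDS.IsExpRegular φ Astar Cρ ρ →
        Cbar₃ * (d * Real.log (NLDS.Rstar d T Cη σ Cρ ρ δ / σ ^ 2) + Real.log (1 / δ)) ≤ T →
        10 / ζ * Real.log (‖(0 : NLDS.Mat d) - Astar‖ ^ 2 * (T * NLDS.Rstar d T Cη σ Cρ ρ δ)
            / (σ ^ 2 * (d : ℝ) ^ 2)) ≤ m →
        1 - δ ≤ P.real {ω |
          let X : ℕ → NLDS.State d := NLDS.trajectory φ Astar 0 (fun t => η t ω)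
          ‖NLDS.quasiNewton φ (1 / 4) T X m - Astar‖ ^ 2
              ≤ Cbar * σ ^ 2 / (T * ζ ^ 2 * NLDS.lambdaMinGram T X)
                * ((d : ℝ) ^ 2 * Real.log (1 + NLDS.Rstar d T Cη σ Cρ ρ δ / σ ^ 2)
                  + d * Real.log (2 * d / δ)) ∧
            σ ^ 2 / 2 ≤ NLDS.lambdaMinGram T X} := by
  -- Here `672000 = 7 * 10 * 9600`: the grid entropy costs `7 log L` per dimension and the
  -- lower-tail exponent is `c₀ T / 10`.
  refine ⟨4 + 84 * Cη, 672000 * (Cη ^ 2 + 1), by positivity, by positivity, ?_⟩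
  intro Ω _ P _ d T m φ Astar η ζ σ Cρ ρ δ hd hσ hδ0 hδ hφ hη hsub hreg hTlarge hm
  have hφc : Continuous φ := hφ.lipschitz.continuous
  have hd' : (1 : ℝ) ≤ d := by exact_mod_cast hd
  have hlogδ : Real.log 2 ≤ Real.log (1 / δ) := by
    refine Real.log_le_log (by norm_num) ?_
    rw [le_div_iff₀ hδ0]; linarith
  have hlog2 := Real.log_two_gt_d9
  have hT : 0 < T := by
    rcases Nat.eq_zero_or_pos T with rfl | h
    -- For `T = 0` the sum in `R*` is empty and `log 0 = 0`, so the sample size condition would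
    -- bound a positive number by zero.
    · have h1 : NLDS.Rstar d 0 Cη σ Cρ ρ δ / σ ^ 2 = 0 := by simp [NLDS.Rstar]
      rw [h1, Real.log_zero, mul_zero, zero_add, Nat.cast_zero] at hTlarge
      have h2 : 0 < 672000 * (Cη ^ 2 + 1) * Real.log (1 / δ) := by
        have : 0 < Real.log (1 / δ) := by linarith
        positivity
      linarith
    · exact h
  have hT' : (1 : ℝ) ≤ T := by exact_mod_cast hT
  have hCη1 : 1 ≤ Cη := by
    have h1 := hη.sq_le_proxy hsub (by positivity) hd
    have h2 : 0 < σ ^ 2 := by positivity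
    nlinarith
  have hCρ := hreg.one_le hd
  have hρ := hreg.rate_nonneg hd
  set Rs := NLDS.Rstar d T Cη σ Cρ ρ δ with hRs
  have hRsd : 2 * d * σ ^ 2 ≤ Rs :=
    NLDS.two_mul_dim_mul_sq_le_Rstar hd hT hδ0 hδ hCη1 hCρ hρ
  set L := Rs / σ ^ 2 with hL
  have hRsL : Rs = L * σ ^ 2 := by rw [hL]; field_simp
  have hLd : 2 * d ≤ L := by rw [hL, le_div_iff₀ (by positivity)]; exact hRsd
  have hL2 : 2 ≤ L := by linarith
  have hlogL : Real.log 2 ≤ Real.log L := Real.log_le_log (by norm_num) hL2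
  set c₀ : ℝ := 1 / (9600 * (Cη ^ 2 + 1)) with hc₀
  have hc₀0 : 0 < c₀ := by positivity
  have hTc : 7 * (d * Real.log L + Real.log (1 / δ)) ≤ c₀ * T / 10 := by
    have h1 := mul_le_mul_of_nonneg_left hTlarge (by positivity : 0 ≤ c₀ / 10)
    have h2 : c₀ / 10 * (672000 * (Cη ^ 2 + 1) * (d * Real.log L + Real.log (1 / δ)))
        = 7 * (d * Real.log L + Real.log (1 / δ)) := by
      rw [hc₀]; field_simp; ring
    linarith
  have hT10 : 10 ≤ T := by
    have h1 : 0 ≤ d * Real.log L := by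
      have : 0 ≤ Real.log L := by linarith
      positivity
    have h2 : c₀ ≤ 1 / 9600 := by
      rw [hc₀]
      refine one_div_le_one_div_of_le (by norm_num) ?_
      nlinarith [sq_nonneg Cη]
    have h3 : (10 : ℝ) ≤ T := by nlinarith
    exact_mod_cast h3
  set K := ⌈16 * L⌉₊ with hK
  have hKL : 16 * L ≤ K := Nat.le_ceil _
  have hK' : (0 : ℝ) < K := by linarith
  have hK0 : 0 < K := by exact_mod_cast hK'
  have hlogK : Real.log (2 * K + 1) ≤ 7 * Real.log L := NLDS.log_two_mul_ceil_le hL2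
  set v := Cη * σ ^ 2 with hv
  have hv0 : 0 < v := by positivity
  have hlogT : 0 ≤ Real.log (4 * T * d / δ) := by
    refine Real.log_nonneg ?_
    rw [le_div_iff₀ hδ0]
    nlinarith
  set B := Real.sqrt (2 * v * Real.log (4 * T * d / δ)) with hB
  have hBsq : B ^ 2 = 2 * v * Real.log (4 * T * d / δ) := Real.sq_sqrt (by positivity)
  have hB0 : 0 ≤ B := Real.sqrt_nonneg _
  set R := Cρ * (∑ t ∈ Finset.range T, ρ ^ t) * (Real.sqrt d * B) with hR
  have hR0 : 0 ≤ R := by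
    have : 0 ≤ ∑ t ∈ Finset.range T, ρ ^ t := Finset.sum_nonneg fun t _ => by positivity
    positivity
  -- The definition of `R*` is twice-matched here: the state bound from regularity and the noise
  -- level `√d B` has square exactly `2 R*`.
  have hRsq : R ^ 2 = 2 * Rs := by
    rw [hR, mul_pow, mul_pow, mul_pow, Real.sq_sqrt (by positivity), hBsq, hRs, NLDS.Rstar, hv]
    ring
  have hRK : (R * (Real.sqrt d / K)) ^ 2 ≤ σ ^ 2 / 128 :=
    NLDS.sq_mul_sqrt_div_le (by rw [hRsq, hRsL]) hLd hKL hK'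
  have hKd : 32 * Real.sqrt d ≤ K := by
    have : Real.sqrt d ≤ d := Real.sqrt_le_iff.2 ⟨by positivity, le_self_pow₀ hd' two_ne_zero⟩
    linarith
  set ℓ := d * Real.log (2 * K + 1) + Real.log (4 * d / δ) with hℓ
  have hℓ0 : 0 < ℓ := by
    have h1 : 0 ≤ Real.log (2 * (K : ℝ) + 1) := Real.log_nonneg (by linarith)
    have h2 : 0 < Real.log (4 * d / δ) := by
      refine Real.log_pos ?_
      rw [lt_div_iff₀ hδ0]; linarith
    positivity
  set r := Real.sqrt (6 * v * ℓ) / (v * Real.sqrt (T * (σ ^ 2 / 2))) with hr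
  have hb1 := NLDS.measureReal_exists_coord_ge_le hsub hv0 hd hT hδ0 (by linarith)
  have hb2 := NLDS.measureReal_exists_grid_design_sq_le (A := Astar) (K := K) (r := 1) hCη hσ hη
    hsub hφc hc₀ hT10 hδ0 (by
      have h1 : d * Real.log (2 * K + 1) ≤ d * (7 * Real.log L) := by gcongr
      have h2 : Real.log (4 / δ) ≤ 3 * Real.log (1 / δ) := by
        have h3 : 4 / δ = 2 ^ 2 * (1 / δ) := by ring
        rw [h3, Real.log_mul (by norm_num) (by positivity), Real.log_pow]
        push_cast
        linarith
      have h3 : 0 ≤ Real.log (1 / δ) := by linarith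
      linarith)
  have hb3 := NLDS.measureReal_exists_grid_selfNormalized_ge_le (A := Astar) (K := K) (r := r) hη
    hsub hv0.le hφc hd hδ0
  rw [← hB] at hb1
  rw [← hℓ] at hb3
  set S := {ω | let X : ℕ → NLDS.State d := NLDS.trajectory φ Astar 0 (fun t => η t ω)
          ‖NLDS.quasiNewton φ (1 / 4) T X m - Astar‖ ^ 2
              ≤ (4 + 84 * Cη) * σ ^ 2 / (T * ζ ^ 2 * NLDS.lambdaMinGram T X)
                * ((d : ℝ) ^ 2 * Real.log (1 + L) + d * Real.log (2 * d / δ)) ∧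
            σ ^ 2 / 2 ≤ NLDS.lambdaMinGram T X} with hS
  set E₁ := {ω | ∃ t < T, ∃ i, B ≤ |η t ω i|} with hE₁
  set E₂ := {ω | ∃ u ∈ NLDS.grid d 1 K, 31 / 32 ≤ ‖u‖ ∧ ‖u‖ ≤ 33 / 32 ∧
      ‖NLDS.design T (NLDS.trajectory φ Astar 0 fun t => η t ω) u‖ ^ 2
        ≤ 2 / 3 * σ ^ 2 * T} with hE₂
  set E₃ := {ω | ∃ i, ∃ u ∈ NLDS.grid d r K, ℓ ≤
        inner ℝ (WithLp.toLp 2 fun t : Fin T => η t ω i)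
          (NLDS.design T (NLDS.trajectory φ Astar 0 fun t => η t ω) u)
        - v / 2 * ‖NLDS.design T (NLDS.trajectory φ Astar 0 fun t => η t ω) u‖ ^ 2} with hE₃
  have hgood : ∀ ω, ω ∉ E₁ → ω ∉ E₂ → ω ∉ E₃ → ω ∈ S := by
    intro ω h1 h2 h3
    simp only [hE₁, hE₂, hE₃, Set.mem_ofPred_eq, not_exists, not_and, not_le] at h1 h2 h3
    set X : ℕ → NLDS.State d := NLDS.trajectory φ Astar 0 (fun t => η t ω) with hX
    have hnoise : ∀ s < T, ‖η s ω‖ ≤ Real.sqrt d * B := by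
      intro s hs
      refine abs_le_of_sq_le_sq' ?_ (by positivity) |>.2
      rw [EuclideanSpace.norm_sq_eq, mul_pow, Real.sq_sqrt (by positivity)]
      refine (Finset.sum_le_sum (g := fun _ => B ^ 2) fun i _ =>
        pow_le_pow_left₀ (norm_nonneg _) (h1 s hs i).le 2).trans_eq ?_
      simp
    have hXR : ∀ t < T, ‖X t‖ ≤ R := by
      intro t ht
      refine (NLDS.norm_trajectory_le hφ.map_zero hreg (by linarith) hρ t _
        fun s hs => hnoise s (hs.trans ht)).trans ?_
      rw [hR]
      have : ∑ k ∈ Finset.range t, ρ ^ k ≤ ∑ k ∈ Finset.range T, ρ ^ k :=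
        Finset.sum_le_sum_of_subset_of_nonneg (Finset.range_mono ht.le)
          fun k _ _ => by positivity
      gcongr
    have hlam : σ ^ 2 / 2 ≤ NLDS.lambdaMinGram T X :=
      NLDS.half_sq_le_lambdaMinGram hd hT hK0 hKd hR0 hXR hRK h2
    have hlam0 : 0 < NLDS.lambdaMinGram T X := lt_of_lt_of_le (by positivity) hlam
    refine ⟨?_, hlam⟩
    refine NLDS.norm_quasiNewton_sub_sq_le_of_bounds (e := fun t => η t ω) hd hT hσ hδ0 hδ hCη hφ
      (fun t _ => rfl) hlam0 hR0 hXR hRsq hL2 hm ?_ hlogK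
    exact fun j b hb => NLDS.norm_design_sq_le_of_grid hT hσ hK0 hR0 hXR hRK hv0 hℓ0 hlam
      (g := fun t => η t ω j) (h3 j) hb
  -- Covering the whole space and using subadditivity avoids any measurability claim about the good
  -- event `S`; the bad events cost `δ/2 + δ/4 + δ/4`.
  have hcover : (Set.univ : Set Ω) ⊆ S ∪ (E₁ ∪ (E₂ ∪ E₃)) := by
    intro ω _
    by_contra hcon
    simp only [Set.mem_union, not_or] at hcon
    exact hcon.1 (hgood ω hcon.2.1 hcon.2.2.1 hcon.2.2.2)
  have h1 := measureReal_mono (μ := P) hcover (measure_ne_top _ _)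
  rw [probReal_univ] at h1
  have h2 := measureReal_union_le (μ := P) S (E₁ ∪ (E₂ ∪ E₃))
  have h3 := measureReal_union_le (μ := P) E₁ (E₂ ∪ E₃)
  have h4 := measureReal_union_le (μ := P) E₂ E₃
  linarith
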